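/- **Setting.** For $n,m,p\ge 0$ let $\mathrm{Rat}^n_{p,m}$ be the set of $p\times m$ strictly proper real rational transfer functions of (McMillan) degree $n$, i.e. those of the form $G(s)=C(sI_n-A)^{-1}B$ with $(A,B,C)\in\mathbb R^{n\times n}\times\mathbb R^{n\times m}\times\mathbb R^{p\times n}$ minimal (controllable and observable). It carries the quotient topology (and manifold structure) coming from the space of minimal triples, two minimal triples having the same transfer function exactly when they are similar. A rational matrix is *stable* if all its poles lie in the open left half-plane. Let $$\|E\|_{\mathcal H_2}^2=\operatorname{tr}\int_{-\infty}^{\infty}E(j\omega)^HE(j\omega)\,\frac{d\omega}{2\pi}$$ if $E$ is stable, and $\|E\|_{\mathcal H_2}=\infty$ otherwise. For $H\in\mathrm{Rat}^N_{p,m}$ and $n\ge 0$ put $$\mathcal J_H(\hat A,\hat B,\hat C)=\|H(s)-\hat C(sI_n-\hat A)^{-1}\hat B\|_{\mathcal H_2}^2 .$$ Let $H\in\mathrm{Rat}^N_{p,m}$ and $\hat H\in\mathrm{Rat}^n_{p,m}$ be stable. We call $\hat H$ * a *stationary point of the $\mathcal H_2$-distance to $H$* if the gradient of $\mathcal J_H$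 vanishes at a (equivalently, every) minimal realization $(\hat A,\hat B,\hat C)$ of $\hat H$; * a *nondegenerate local minimum of the $\mathcal H_2$-distance to $H$* if $\hat H$ is a local minimum of $G\mapsto\|H-G\|_{\mathcal H_2}$ on $\mathrm{Rat}^n_{p,m}$ and the Hessian of $\|H-G\|^2_{\mathcal H_2}$ at $\hat H$ is nondegenerate on the tangent space of $\mathrm{Rat}^n_{p,m}$; equivalently, at a minimal realization $(\hat A,\hat B,\hat C)$ of $\hat H$, every vector in the kernel of the Hessian of $\mathcal J_H$ has the form $(K\hat A-\hat AK,\;K\hat B,\;-\hat CK)$ with $K\in\mathbb R^{n\times n}$, i.e. is tangent to the similarity class of $(\hat A,\hat B,\hat C)$. **Theorem.** Let $H\in\mathrm{Rat}^N_{p,m}$ and $\hat H\in\mathrm{Rat}^n_{p,m}$ be stable, and suppose that $\hat H$ is a stationary point (resp. a nondegenerate local minimum) of the $\mathcal H_2$-distance to $H$. Then for every neighborhood $\mathcal U$ of $H$ in $\mathrm{Rat}^N_{p,m}$ there is a neighborhood $\hat{\mathcal U}$ of $\hat H$ in $\mathrm{Rat}^n_{p,m}$ such that for every $\hat H_\Delta\in\hat{\mathcal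 U}$ there is $H_\Delta\in\mathcal U$ such that $H_\Delta$ and $\hat H_\Delta$ are stable and $\hat H_\Delta$ is a stationary point (resp. a nondegenerate local minimum) of the $\mathcal H_2$-distance to $H_\Delta$. -/

import Mathlib

open Topology MeasureTheory

-- Real matrices carry the entrywise sup norm; as the spaces are finite dimensional, derivatives
-- and topology do not depend on this choice.
attribute [local instance] Matrix.normedAddCommGroup Matrix.normedSpace

namespace H2

/-- A real state-space triple `(A, B, C)` with `n` states, `m` inputs and `p` outputs. -/
abbrev Triple (n p m : ℕ) : Type :=
  Matrix (Fin n) (Fin n) ℝ × Matrix (Fin n) (Fin m) ℝ × Matrix (Fin p) (Fin n) ℝ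

/-- A `p × m` matrix of real rational functions of the variable `s`. -/
abbrev RatMatrix (p m : ℕ) : Type := Matrix (Fin p) (Fin m) (RatFunc ℝ)

/-- The controllability matrix `[B, A B, …, A ^ (n - 1) B]`. -/
def ctrbMatrix {n p m : ℕ} (x : Triple n p m) : Matrix (Fin n) (Fin n × Fin m) ℝ :=
  Matrix.of fun i kj => (x.1 ^ (kj.1 : ℕ) * x.2.1) i kj.2

/-- The observability matrix, with block rows `C, C A, …, C A ^ (n - 1)`. -/
def obsvMatrix {n p m : ℕ} (x : Triple n p m) : Matrix (Fin n × Fin p) (Fin n) ℝ :=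
  Matrix.of fun ki j => (x.2.2 * x.1 ^ (ki.1 : ℕ)) ki.2 j

/-- A triple is minimal if it is controllable and observable. -/
def IsMinimal {n p m : ℕ} (x : Triple n p m) : Prop :=
  (ctrbMatrix x).rank = n ∧ (obsvMatrix x).rank = n

/-- The transfer function `C (s I - A)⁻¹ B`. The matrix `s I - A` is always invertible over the
field of rational functions, its determinant being the characteristic polynomial of `A`. -/
noncomputable def transfer {n p m : ℕ} (x : Triple n p m) : RatMatrix p m :=
  x.2.2.map RatFunc.C
    * ((RatFunc.X : RatFunc ℝ) • (1 : Matrix (Fin n) (Fin n) (RatFunc ℝ))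
        - x.1.map RatFunc.C)⁻¹
    * x.2.1.map RatFunc.C

/-- The set of `p × m` strictly proper real rational transfer functions of (McMillan) degree `n`,
that is, those with a minimal realization with `n` states. -/
def RatTF (n p m : ℕ) : Type :=
  {G : RatMatrix p m // ∃ x : Triple n p m, IsMinimal x ∧ transfer x = G}

/-- The map sending a minimal triple to its transfer function. -/
noncomputable def RatTF.ofMinimal {n p m : ℕ} (x : {x : Triple n p m // IsMinimal x}) :
    RatTF n p m :=
  ⟨transfer x.1, x.1, x.2, rfl⟩

/-- The topology of the space of transfer functions of degree `n`: the quotient topology of the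
space of minimal triples `(A, B, C)`. -/
noncomputable instance (n p m : ℕ) : TopologicalSpace (RatTF n p m) :=
  TopologicalSpace.coinduced RatTF.ofMinimal inferInstance

/-- A rational matrix is stable if all the poles of its entries lie in the open left half-plane. -/
def IsStable {p m : ℕ} (E : RatMatrix p m) : Prop :=
  ∀ i j, ∀ s : ℂ, Polynomial.aeval s (E i j).denom = 0 → s.re < 0

/-- The value `E(s)` at a complex number `s`. -/
noncomputable def evalAt {p m : ℕ} (E : RatMatrix p m) (s : ℂ) : Matrix (Fin p) (Fin m) ℂ :=
  E.map (RatFunc.eval (algebraMap ℝ ℂ) s)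

open Classical in
/-- The squared `H₂` norm: `∞` if `E` is unstable and otherwise
`tr ∫ E(jω)ᴴ E(jω) dω / (2π)` over the real line. -/
noncomputable def h2NormSq {p m : ℕ} (E : RatMatrix p m) : ENNReal :=
  if IsStable E then
    (∫⁻ ω : ℝ, ENNReal.ofReal
      ((evalAt E (Complex.I * ω)).conjTranspose * evalAt E (Complex.I * ω)).trace.re)
      / ENNReal.ofReal (2 * Real.pi)
  else ⊤

/-- The squared `H₂` error `‖H(s) - C (s I - A)⁻¹ B‖²` as a real function of the entries of the
triple `(A, B, C)`. (It is finite whenever `H` and `C (s I - A)⁻¹ B` are stable.) -/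
noncomputable def errorFn {p m : ℕ} (H : RatMatrix p m) {n : ℕ} (x : Triple n p m) : ℝ :=
  (h2NormSq (H - transfer x)).toReal

/-- `G` is a stationary point of the `H₂` distance to `H`: the gradients of the squared error with
respect to the matrices of a minimal realization `(A, B, C)` of `G` vanish. Minimal realizations of
`G` being similar to each other, it does not matter which one is taken. -/
def IsStationaryPoint {p m : ℕ} (H : RatMatrix p m) {n : ℕ} (G : RatTF n p m) : Prop :=
  ∃ x : Triple n p m, IsMinimal x ∧ transfer x = G.1 ∧
    HasFDerivAt (errorFn H (n := n)) (0 : Triple n p m →L[ℝ] ℝ) x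

/-- The tangent vectors at `(A, B, C)` to its similarity class
`{(T A T⁻¹, T B, C T⁻¹) | T invertible}`, which for a minimal triple is the set of all the minimal
triples with the same transfer function. Hence the tangent space of the manifold of
transfer functions of degree `n` is the space of all triples modulo these vectors. -/
def IsSimilarityTangent {n p m : ℕ} (x v : Triple n p m) : Prop :=
  ∃ K : Matrix (Fin n) (Fin n) ℝ,
    v = (K * x.1 - x.1 * K, K * x.2.1, -(x.2.2 * K))

/-- `G` is a nondegenerate local minimum of the `H₂` distance to `H`: it is a local minimum over the
space of transfer functions of degree `n`, and the Hessian there of the squared error is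
nondegenerate on the tangent space of that manifold, that is, in terms of a
minimal realization of `G` (it does not matter which), the kernel of the Hessian
consists only of vectors tangent to the similarity class. -/
def IsNondegLocalMin {p m : ℕ} (H : RatMatrix p m) {n : ℕ} (G : RatTF n p m) : Prop :=
  IsLocalMin (fun G' : RatTF n p m => h2NormSq (H - G'.1)) G ∧
  ∃ x : Triple n p m, IsMinimal x ∧ transfer x = G.1 ∧
    ∀ v : Triple n p m,
      (∀ w : Triple n p m, fderiv ℝ (fderiv ℝ (errorFn H (n := n))) x v w = 0) →
        IsSimilarityTangent x v

end H2

/-! For stable realizations the squared error is an algebraic function of the matrices: `distSq h x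
= ip h h - 2 * ip h x + ip x x`, where `ip` is a trace containing the solution of a Sylvester
equation. It is smooth, so the problem moves from transfer functions to triples.

Write h = (A, B, C) for the target and x = (Â, B̂, Ĉ) for the reduced model, X and Y for their mixed
Gramians, P and Q for the Gramians of x alone. Stationarity means C X = Ĉ P, Yᵀ B = Q B̂ and Yᵀ X =
Q P (`hasFDerivAt_distSq_zero_iff`). With V = X P⁻¹ and W = Q⁻¹ Yᵀ this gives W V = 1, W B = B̂, C V
= Ĉ, and then W A V = Â: x is an oblique projection of h. Moreover, for E = 1 - V W the Sylvester
equations force the off-diagonal blocks E A V = -E B B̂ᵀ P⁻¹ and W A E = -Q⁻¹ Ĉᵀ C E, while E A E, E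
B and C E are unconstrained (`exists_inflate_eq`). Conversely, keep V, W and the unconstrained
blocks fixed and insert any nearby y in place of x, with the coupling blocks that y dictates: then y
is stationary for the new target (`hasFDerivAt_distSq_inflate`). This target depends continuously on
y and equals h at y = x, which settles stationary points.

For nondegenerate minima the same deformation is used. At a stationary point the Hessian kills the
directions tangent to the similarity class, and at a nondegenerate minimum it is positive definite
on a complement Z. Positivity on Z and transversality of Z survive small changes of target and
model. Together with stationarity they give a local minimum again, because every triple near y is
similar to one in y + Z (`eventually_isLocalMin_and_nondegenerate`).

Passing between triples and transfer functions uses three facts: minimal realizations of stable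
functions are Hurwitz (`isHurwitz_of_isStable_transfer`), minimal realizations of the same function
are similar (`exists_act_eq_of_transfer_eq`), and hence the quotient map is open
(`isOpenMap_ofMinimal`). -/

namespace H2

/-! ### Norms on real matrix spaces. -/

section MatrixNorm

/-- The entrywise sup norm, with the topology and the module structure of matrices as the
underlying instances. -/
noncomputable instance normedMatrix (a b : ℕ) : NormedAddCommGroup (Matrix (Fin a) (Fin b) ℝ) where
  toAddCommGroup := Matrix.addCommGroup
  norm := (Pi.normedAddCommGroup : NormedAddCommGroup (Fin a → Fin b → ℝ)).norm
  dist := (Pi.normedAddCommGroup : NormedAddCommGroup (Fin a → Fin b → ℝ)).dist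
  edist := (pseudoEMetricSpacePi : PseudoEMetricSpace (Fin a → Fin b → ℝ)).edist
  toUniformSpace :=
    { toTopologicalSpace := instTopologicalSpaceMatrix
      uniformity := (Pi.uniformSpace _ : UniformSpace (Fin a → Fin b → ℝ)).uniformity
      symm := (Pi.uniformSpace _ : UniformSpace (Fin a → Fin b → ℝ)).symm
      comp := (Pi.uniformSpace _ : UniformSpace (Fin a → Fin b → ℝ)).comp
      nhds_eq_comap_uniformity :=
        (Pi.uniformSpace _ : UniformSpace (Fin a → Fin b → ℝ)).nhds_eq_comap_uniformity }
  dist_self := dist_self (α := Fin a → Fin b → ℝ)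
  dist_comm := dist_comm (α := Fin a → Fin b → ℝ)
  dist_triangle := dist_triangle (α := Fin a → Fin b → ℝ)
  edist_dist := edist_dist (α := Fin a → Fin b → ℝ)
  uniformity_dist := Metric.uniformity_eq_comap_nhds_zero (α := Fin a → Fin b → ℝ) ▸
    (pseudoMetricSpacePi : PseudoMetricSpace (Fin a → Fin b → ℝ)).uniformity_dist
  toBornology := (Pi.instBornology : Bornology (Fin a → Fin b → ℝ))
  cobounded_sets := (pseudoMetricSpacePi : PseudoMetricSpace (Fin a → Fin b → ℝ)).cobounded_sets
  eq_of_dist_eq_zero := eq_of_dist_eq_zero (γ := Fin a → Fin b → ℝ)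
  dist_eq := dist_eq_norm_neg_add (E := Fin a → Fin b → ℝ)

noncomputable instance normedSpaceMatrix (a b : ℕ) : NormedSpace ℝ (Matrix (Fin a) (Fin b) ℝ) where
  toModule := Matrix.module
  norm_smul_le := norm_smul_le (α := ℝ) (β := Fin a → Fin b → ℝ)

end MatrixNorm

/-- The matrix `s I - A` over the complex numbers. -/
noncomputable def pencil {n : ℕ} (A : Matrix (Fin n) (Fin n) ℝ) (s : ℂ) :
    Matrix (Fin n) (Fin n) ℂ :=
  s • (1 : Matrix (Fin n) (Fin n) ℂ) - A.map (algebraMap ℝ ℂ)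

/-- The resolvent `(s I - A)⁻¹`. -/
noncomputable def res {n : ℕ} (A : Matrix (Fin n) (Fin n) ℝ) (s : ℂ) :
    Matrix (Fin n) (Fin n) ℂ :=
  (pencil A s)⁻¹

/-- A real matrix is Hurwitz if it has no eigenvalue in the closed right half-plane. -/
def IsHurwitz {n : ℕ} (A : Matrix (Fin n) (Fin n) ℝ) : Prop :=
  ∀ s : ℂ, 0 ≤ s.re → (pencil A s).det ≠ 0

/-! ### The resolvent, and openness of the Hurwitz condition. -/

section Resolvent

variable {n : ℕ} (A : Matrix (Fin n) (Fin n) ℝ)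

theorem det_pencil (s : ℂ) : (pencil A s).det = Polynomial.aeval s A.charpoly := by
  have h := Matrix.eval_charpoly (A.map (algebraMap ℝ ℂ)) s
  rw [Matrix.charpoly_map, Polynomial.eval_map_algebraMap] at h
  rw [h, pencil, Matrix.scalar_apply, Matrix.smul_one_eq_diagonal]

theorem continuous_pencil :
    Continuous fun q : Matrix (Fin n) (Fin n) ℝ × ℂ => pencil q.1 q.2 := by
  unfold pencil
  refine (continuous_snd.smul continuous_const).sub ?_
  exact continuous_fst.matrix_map (Complex.continuous_ofReal)

theorem pencil_mul_res {s : ℂ} (h : (pencil A s).det ≠ 0) : pencil A s * res A s = 1 :=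
  Matrix.mul_nonsing_inv _ (isUnit_iff_ne_zero.2 h)

theorem res_mul_pencil {s : ℂ} (h : (pencil A s).det ≠ 0) : res A s * pencil A s = 1 :=
  Matrix.nonsing_inv_mul _ (isUnit_iff_ne_zero.2 h)

theorem smul_res {s : ℂ} (h : (pencil A s).det ≠ 0) :
    s • res A s = 1 + A.map (algebraMap ℝ ℂ) * res A s := by
  have := pencil_mul_res A h
  rw [pencil, sub_mul, smul_mul_assoc, one_mul, sub_eq_iff_eq_add] at this
  exact this

theorem eventually_det_pencil_ne_zero_nhdsNE (l : ℂ) :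
    ∀ᶠ s in 𝓝[≠] l, (pencil A s).det ≠ 0 := by
  have hp : (A.charpoly.map (algebraMap ℝ ℂ)) ≠ 0 :=
    (A.charpoly_monic.map _).ne_zero
  have hfin : ((A.charpoly.map (algebraMap ℝ ℂ)).rootSet ℂ).Finite :=
    Polynomial.rootSet_finite _ _
  have : ∀ᶠ s in 𝓝[≠] l, s ∉ ((A.charpoly.map (algebraMap ℝ ℂ)).rootSet ℂ) := by
    have h2 := hfin.subset (Set.sdiff_subset (t := {l}))
    have h3 := h2.isClosed.isOpen_compl.mem_nhds (x := l) (by simp)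
    filter_upwards [mem_nhdsWithin_of_mem_nhds h3, self_mem_nhdsWithin] with s hs hl hmem
    exact hs ⟨hmem, hl⟩
  filter_upwards [this] with s hs h0
  apply hs
  rw [Polynomial.mem_rootSet]
  refine ⟨hp, ?_⟩
  rw [det_pencil] at h0
  simpa using h0

theorem continuousAt_res {s : ℂ} (h : (pencil A s).det ≠ 0) : ContinuousAt (res A) s := by
  have h1 : ContinuousAt (fun s => pencil A s) s :=
    ((continuous_pencil (n := n)).comp (Continuous.prodMk_right A)).continuousAt
  refine ContinuousAt.comp (g := Inv.inv) (continuousAt_matrix_inv _ ?_) h1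
  rw [Ring.inverse_eq_inv']
  exact continuousAt_inv₀ h

/-- Factoring out s turns behaviour at infinity into behaviour of `1 - s⁻¹ • A` near the identity.
-/
theorem pencil_eq_smul {s : ℂ} (hs : s ≠ 0) :
    pencil A s = s • ((1 : Matrix (Fin n) (Fin n) ℂ) - s⁻¹ • A.map (algebraMap ℝ ℂ)) := by
  rw [smul_sub, smul_smul, mul_inv_cancel₀ hs, one_smul, pencil]

theorem tendsto_one_sub_inv_smul :
    Filter.Tendsto (fun s : ℂ => (1 : Matrix (Fin n) (Fin n) ℂ)
      - s⁻¹ • A.map (algebraMap ℝ ℂ)) (Bornology.cobounded ℂ) (𝓝 1) := by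
  have := (Filter.tendsto_inv₀_cobounded (α := ℂ)).smul_const (A.map (algebraMap ℝ ℂ))
  simpa using tendsto_const_nhds.sub this

theorem eventually_det_pencil_ne_zero_cobounded :
    ∀ᶠ s in Bornology.cobounded ℂ, (pencil A s).det ≠ 0 := by
  have h := ((continuous_id (X := Matrix (Fin n) (Fin n) ℂ)).matrix_det.tendsto 1).comp
    (tendsto_one_sub_inv_smul A)
  rw [id, Matrix.det_one] at h
  filter_upwards [h.eventually_ne one_ne_zero, Bornology.eventually_ne_cobounded (0 : ℂ)]
    with s hs h0
  rw [pencil_eq_smul A h0, Matrix.det_smul]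
  exact mul_ne_zero (pow_ne_zero _ h0) hs

theorem tendsto_smul_res :
    Filter.Tendsto (fun s => s • res A s) (Bornology.cobounded ℂ) (𝓝 1) := by
  have h2 : ContinuousAt (Inv.inv : Matrix (Fin n) (Fin n) ℂ → _) 1 := by
    refine continuousAt_matrix_inv _ ?_
    rw [Ring.inverse_eq_inv']
    exact continuousAt_inv₀ (by simp)
  have h3 := h2.tendsto.comp (tendsto_one_sub_inv_smul A)
  rw [inv_one] at h3
  refine h3.congr' ?_
  filter_upwards [Bornology.eventually_ne_cobounded (0 : ℂ),
    eventually_det_pencil_ne_zero_cobounded A] with s hs hd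
  refine Matrix.inv_eq_left_inv ?_
  rw [smul_mul_assoc, ← mul_smul_comm, ← pencil_eq_smul A hs, res_mul_pencil A hd]

theorem tendsto_res : Filter.Tendsto (res A) (Bornology.cobounded ℂ) (𝓝 0) := by
  have := (Filter.tendsto_inv₀_cobounded (α := ℂ)).smul (tendsto_smul_res A)
  rw [zero_smul] at this
  refine this.congr' ?_
  filter_upwards [Bornology.eventually_ne_cobounded (0 : ℂ)] with s hs
  rw [smul_smul, inv_mul_cancel₀ hs, one_smul]

/-- The closed right half-plane is not compact, so it is cut at a large radius: on the half-disc the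
tube lemma applies, and outside it `1 - s⁻¹ • A'` is invertible uniformly for `A'` near `A`, since
s⁻¹ is small. -/
theorem isOpen_isHurwitz : IsOpen {A : Matrix (Fin n) (Fin n) ℝ | IsHurwitz A} := by
  rw [isOpen_iff_mem_nhds]
  intro A hA
  have hsmall : ∀ᶠ q : Matrix (Fin n) (Fin n) ℝ × ℂ in 𝓝 (A, 0),
      ((1 : Matrix (Fin n) (Fin n) ℂ) - q.2 • q.1.map (algebraMap ℝ ℂ)).det ≠ 0 := by
    have hc : Continuous fun q : Matrix (Fin n) (Fin n) ℝ × ℂ =>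
        ((1 : Matrix (Fin n) (Fin n) ℂ) - q.2 • q.1.map (algebraMap ℝ ℂ)).det := by
      refine Continuous.matrix_det (continuous_const.sub (continuous_snd.smul ?_))
      exact continuous_fst.matrix_map Complex.continuous_ofReal
    refine hc.continuousAt.eventually_ne ?_
    simp
  rw [nhds_prod_eq] at hsmall
  obtain ⟨pa, ha, pb, hb, hab⟩ := Filter.eventually_prod_iff.1 hsmall
  obtain ⟨δ, hδ, hball⟩ := Metric.eventually_nhds_iff.1 hb
  have hK : IsCompact (Metric.closedBall (0 : ℂ) δ⁻¹ ∩ {s : ℂ | 0 ≤ s.re}) :=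
    (isCompact_closedBall _ _).inter_right (isClosed_le continuous_const Complex.continuous_re)
  have hcomp := hK.eventually_forall_of_forall_eventually (x₀ := A)
    (P := fun A s => (pencil A s).det ≠ 0) (by
      intro s hs
      exact (continuous_pencil (n := n)).matrix_det.continuousAt.eventually_ne (hA s hs.2))
  filter_upwards [ha, hcomp] with A' h1 h2 s hs
  by_cases hle : ‖s‖ ≤ δ⁻¹
  · exact h2 s ⟨by simpa using hle, hs⟩
  · push Not at hle
    have hs0 : s ≠ 0 := by
      rintro rfl
      rw [norm_zero] at hle
      exact absurd hle (not_lt.2 (inv_nonneg.2 hδ.le))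
    rw [pencil_eq_smul A' hs0, Matrix.det_smul]
    refine mul_ne_zero (pow_ne_zero _ hs0) (hab h1 (hball ?_))
    rw [dist_zero_right, norm_inv]
    exact inv_lt_of_inv_lt₀ hδ hle

end Resolvent
-- Contour integration in the right half-plane.
section HalfPlane

/-- Cauchy's theorem in the right half-plane for a function that decays quadratically. -/
theorem integral_imaginary_axis_eq_zero {f : ℂ → ℂ} (hf : ∀ s : ℂ, 0 ≤ s.re → DifferentiableAt ℂ f s)
    {L : ℂ} (hL : Filter.Tendsto (fun s => s ^ 2 * f s) (Bornology.cobounded ℂ) (𝓝 L)) :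
    Integrable (fun y : ℝ => f (y * Complex.I)) ∧ ∫ y : ℝ, f (y * Complex.I) = 0 := by
  obtain ⟨R, hR0, hR⟩ : ∃ R : ℝ, 0 < R ∧ ∀ s : ℂ, R ≤ ‖s‖ → ‖f s‖ ≤ (‖L‖ + 1) / ‖s‖ ^ 2 := by
    have h1 : ∀ᶠ s in Bornology.cobounded ℂ, ‖s ^ 2 * f s‖ < ‖L‖ + 1 :=
      hL.norm.eventually_lt_const (by linarith)
    obtain ⟨R, -, hR⟩ := (Filter.HasBasis.eventually_iff
      (Metric.hasBasis_cobounded_compl_closedBall (0 : ℂ))).1 h1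
    refine ⟨max R 0 + 1, by positivity, fun s hs => ?_⟩
    have hpos : 0 < ‖s‖ := lt_of_lt_of_le (by positivity) hs
    have h2 := hR (x := s) (by
      simp only [Set.mem_compl_iff, Metric.mem_closedBall, dist_zero_right, not_le]
      linarith [le_max_left R 0])
    rw [norm_mul, norm_pow] at h2
    rw [le_div_iff₀ (by positivity)]
    linarith
  have hcont : Continuous fun y : ℝ => f (y * Complex.I) := by
    rw [continuous_iff_continuousAt]
    intro y
    refine ContinuousAt.comp (g := f) (hf _ (by simp)).continuousAt ?_
    fun_prop
  have hint : Integrable (fun y : ℝ => f (y * Complex.I)) := by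
    have hg : Integrable fun y : ℝ => (1 + y ^ 2)⁻¹ := integrable_inv_one_add_sq
    refine hcont.locallyIntegrable.integrable_of_isBigO_cocompact (g := fun y : ℝ => (1 + y ^ 2)⁻¹) ?_
      (hg.integrableAtFilter _)
    refine Asymptotics.IsBigO.of_bound (2 * (‖L‖ + 1)) ?_
    have h2 : ∀ᶠ y : ℝ in Filter.cocompact ℝ, max R 1 < ‖y‖ := by
      rw [← Metric.cobounded_eq_cocompact]
      exact tendsto_norm_cobounded_atTop.eventually_gt_atTop _
    filter_upwards [h2] with y hy
    have hn : ‖(y * Complex.I : ℂ)‖ = ‖y‖ := by simp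
    have h3 := hR (y * Complex.I) (by rw [hn]; exact (le_max_left _ _).trans hy.le)
    rw [hn, Real.norm_eq_abs, sq_abs] at h3
    refine h3.trans ?_
    have hy1 : 1 ≤ y ^ 2 := by
      rw [← sq_abs, ← Real.norm_eq_abs]
      nlinarith [le_max_right R 1]
    rw [Real.norm_of_nonneg (by positivity), ← div_eq_mul_inv,
      div_le_div_iff₀ (by positivity) (by positivity)]
    nlinarith [norm_nonneg L]
  refine ⟨hint, ?_⟩
  have hlim := intervalIntegral_tendsto_integral hint (Filter.tendsto_neg_atTop_atBot)
    (Filter.tendsto_id (α := ℝ) (x := Filter.atTop))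
  refine tendsto_nhds_unique hlim ?_
  -- Cauchy's theorem on the rectangle [0, r] × [-r, r]: the three sides off the imaginary axis have
  -- total length 4r and lie at distance at least r from the origin, where f is at most (‖L‖ + 1) /
  -- r².
  refine squeeze_zero_norm' (a := fun r : ℝ => 4 * (‖L‖ + 1) / r) ?_
    (tendsto_const_nhds.div_atTop Filter.tendsto_id)
  filter_upwards [Filter.eventually_ge_atTop R] with r hr
  have hr0 : 0 < r := hR0.trans_le hr
  have hrect := Complex.integral_boundary_rect_eq_zero_of_differentiableOn f (-(r * Complex.I))
    (r + r * Complex.I) (by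
      intro s hs
      refine (hf s ?_).differentiableWithinAt
      have := hs.1
      simp [Set.uIcc_of_le hr0.le] at this
      exact this.1)
  simp only [Complex.neg_re, Complex.mul_re, Complex.ofReal_re, Complex.I_re, mul_zero,
    Complex.ofReal_im, Complex.I_im, mul_one, sub_self, neg_zero, Complex.add_re, add_zero,
    Complex.neg_im, Complex.mul_im, zero_add, Complex.add_im, Complex.ofReal_zero] at hrect
  have hbd : ∀ s : ℂ, r ≤ ‖s‖ → ‖f s‖ ≤ (‖L‖ + 1) / r ^ 2 := fun s hs =>
    (hR s (hr.trans hs)).trans (by gcongr)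
  have e1 := intervalIntegral.norm_integral_le_of_norm_le_const (a := (0 : ℝ)) (b := r)
    (f := fun x : ℝ => f (x + ((-r : ℝ) : ℂ) * Complex.I)) (C := (‖L‖ + 1) / r ^ 2) (fun x _ => hbd _ (by
      refine le_trans ?_ (Complex.abs_im_le_norm _)
      simp [abs_of_pos hr0]))
  have e2 := intervalIntegral.norm_integral_le_of_norm_le_const (a := (0 : ℝ)) (b := r)
    (f := fun x : ℝ => f (x + (r : ℂ) * Complex.I)) (C := (‖L‖ + 1) / r ^ 2) (fun x _ => hbd _ (by
      refine le_trans ?_ (Complex.abs_im_le_norm _)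
      simp [abs_of_pos hr0]))
  have e3 := intervalIntegral.norm_integral_le_of_norm_le_const (a := -r) (b := r)
    (f := fun y : ℝ => f (r + (y : ℂ) * Complex.I)) (C := (‖L‖ + 1) / r ^ 2) (fun x _ => hbd _ (by
      refine le_trans ?_ (Complex.abs_re_le_norm _)
      simp [abs_of_pos hr0]))
  set I1 := ∫ x : ℝ in (0 : ℝ)..r, f (x + ((-r : ℝ) : ℂ) * Complex.I)
  set I2 := ∫ x : ℝ in (0 : ℝ)..r, f (x + (r : ℂ) * Complex.I)
  set I3 := ∫ y : ℝ in (-r)..r, f (r + (y : ℂ) * Complex.I)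
  have h0 : ∫ y : ℝ in (-r)..r, f (y * Complex.I) = -Complex.I * (I1 - I2) + I3 := by
    have : Complex.I * Complex.I = -1 := Complex.I_mul_I
    generalize (∫ y : ℝ in (-r)..r, f (y * Complex.I)) = I4 at hrect ⊢
    simp only [smul_eq_mul] at hrect
    linear_combination Complex.I * hrect - (I3 - I4) * this
  simp only [id]
  rw [h0]
  rw [abs_of_pos (by linarith)] at e1 e2 e3
  calc ‖-Complex.I * (I1 - I2) + I3‖ ≤ ‖-Complex.I * (I1 - I2)‖ + ‖I3‖ := norm_add_le _ _
    _ ≤ (‖I1‖ + ‖I2‖) + ‖I3‖ := by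
        gcongr
        rw [norm_mul, norm_neg, Complex.norm_I, one_mul]
        exact norm_sub_le _ _
    _ ≤ ((‖L‖ + 1) / r ^ 2 * (r - 0) + (‖L‖ + 1) / r ^ 2 * (r - 0)) + (‖L‖ + 1) / r ^ 2 * (r - -r) := by
        gcongr
    _ = 4 * (‖L‖ + 1) / r := by field_simp; ring

/-- The resolvent identity turns the difference quotient into a product of two resolvents, whose
limit follows from continuity. -/
theorem hasDerivAt_trace_res_mul {n : ℕ} (A : Matrix (Fin n) (Fin n) ℝ)
    (M : Matrix (Fin n) (Fin n) ℂ) {s : ℂ} (h : (pencil A s).det ≠ 0) :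
    HasDerivAt (fun s => (res A s * M).trace) (-(res A s * res A s * M).trace) s := by
  rw [hasDerivAt_iff_tendsto_slope]
  have hlim : Filter.Tendsto (fun t => -(res A t * res A s * M).trace) (𝓝[≠] s)
      (𝓝 (-(res A s * res A s * M).trace)) := by
    have hc : Continuous fun X : Matrix (Fin n) (Fin n) ℂ => -(X * res A s * M).trace := by
      fun_prop
    exact (hc.continuousAt.tendsto.comp (continuousAt_res A h)).mono_left nhdsWithin_le_nhds
  refine hlim.congr' ?_
  filter_upwards [eventually_det_pencil_ne_zero_nhdsNE A s, self_mem_nhdsWithin] with t ht hts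
  have hts' : t - s ≠ 0 := sub_ne_zero.2 hts
  have key : res A t - res A s = -((t - s) • (res A t * res A s)) := by
    have h1 : pencil A s - pencil A t = -((t - s) • (1 : Matrix (Fin n) (Fin n) ℂ)) := by
      rw [pencil, pencil, sub_smul]
      abel
    calc res A t - res A s
        = res A t * (pencil A s * res A s) - res A t * pencil A t * res A s := by
          rw [pencil_mul_res A h, res_mul_pencil A ht, mul_one, one_mul]
      _ = res A t * (pencil A s - pencil A t) * res A s := by
          rw [mul_sub, sub_mul, mul_assoc, mul_assoc]
      _ = _ := by rw [h1]; simp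
  rw [slope_def_field, ← Matrix.trace_sub, ← sub_mul, key, eq_div_iff hts']
  simp [mul_comm]

/-- The integral over the imaginary axis of the real part of a linear functional of the
resolvent. -/
theorem integral_re_trace_res {n : ℕ} {A : Matrix (Fin n) (Fin n) ℝ} (hA : IsHurwitz A)
    (M : Matrix (Fin n) (Fin n) ℝ) :
    Integrable (fun y : ℝ => (res A (y * Complex.I) * M.map (algebraMap ℝ ℂ)).trace.re) ∧
      ∫ y : ℝ, (res A (y * Complex.I) * M.map (algebraMap ℝ ℂ)).trace.re
        = Real.pi * M.trace := by
  set N := M.map (algebraMap ℝ ℂ) with hN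
  have hne : ∀ s : ℂ, 0 ≤ s.re → s + 1 ≠ 0 := by
    intro s hs h0
    have := congrArg Complex.re h0
    simp at this
    linarith
  -- The trace decays only like tr N / s. Subtracting tr N / (s + 1) leaves quadratic decay, so
  -- Cauchy's theorem gives zero; the subtracted term has real part tr M / (1 + y²) on the axis,
  -- which contributes π tr M.
  obtain ⟨hi, h0⟩ := integral_imaginary_axis_eq_zero
    (f := fun s => (res A s * N).trace - N.trace * (s + 1)⁻¹)
    (L := (N.trace * 1 + (A.map (algebraMap ℝ ℂ) * 1 * N).trace)) (by
      intro s hs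
      refine (hasDerivAt_trace_res_mul A N (hA s hs)).differentiableAt.sub ?_
      have : DifferentiableAt ℂ (fun t : ℂ => (t + 1)⁻¹) s :=
        ((differentiableAt_id (𝕜 := ℂ) (x := s)).add_const (1 : ℂ)).inv (hne s hs)
      exact this.const_mul N.trace) (by
      have h1 : Filter.Tendsto (fun s : ℂ => 1 - (s + 1)⁻¹) (Bornology.cobounded ℂ) (𝓝 1) := by
        have := (Filter.tendsto_inv₀_cobounded (α := ℂ)).comp
          (tendsto_add_const_cobounded (1 : ℂ))
        simpa using tendsto_const_nhds.sub this
      have hc : Continuous fun X : Matrix (Fin n) (Fin n) ℂ =>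
          (A.map (algebraMap ℝ ℂ) * X * N).trace := by fun_prop
      have h2 := (hc.tendsto 1).comp (tendsto_smul_res A)
      refine ((h1.const_mul N.trace).add h2).congr' ?_
      filter_upwards [eventually_det_pencil_ne_zero_cobounded A,
        Bornology.eventually_ne_cobounded (-1 : ℂ)] with s hd hs
      have hs1 : s + 1 ≠ 0 := fun h => hs (eq_neg_of_add_eq_zero_left h)
      have e1 : s ^ 2 * (res A s * N).trace
          = s * N.trace + (A.map (algebraMap ℝ ℂ) * (s • res A s) * N).trace := by
        have : s ^ 2 • res A s = s • (1 : Matrix (Fin n) (Fin n) ℂ)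
            + A.map (algebraMap ℝ ℂ) * (s • res A s) := by
          rw [sq, mul_smul]
          nth_rewrite 1 [smul_res A hd]
          rw [smul_add, mul_smul_comm]
        rw [← smul_eq_mul, ← Matrix.trace_smul, ← smul_mul_assoc, this, add_mul,
          Matrix.trace_add, smul_mul_assoc, one_mul, Matrix.trace_smul, smul_eq_mul]
      simp only [Function.comp]
      rw [mul_sub (s ^ 2), e1]
      field_simp
      ring)
  have hre : ∀ y : ℝ, (res A (y * Complex.I) * N).trace.re
      = ((res A (y * Complex.I) * N).trace - N.trace * (y * Complex.I + 1)⁻¹).re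
        + M.trace * (1 + y ^ 2)⁻¹ := by
    intro y
    have htr : N.trace = (M.trace : ℂ) := by
      simp [hN, Matrix.trace]
    have hinv : ((y * Complex.I + 1 : ℂ)⁻¹).re = (1 + y ^ 2)⁻¹ := by
      rw [Complex.inv_re, Complex.normSq_apply]
      simp
      ring
    rw [Complex.sub_re, htr, Complex.re_ofReal_mul, hinv]
    ring
  simp_rw [hre]
  have hi2 : Integrable fun y : ℝ => M.trace * (1 + y ^ 2)⁻¹ :=
    integrable_inv_one_add_sq.const_mul _
  have hi1 : Integrable fun y : ℝ =>
      ((res A (y * Complex.I) * N).trace - N.trace * (y * Complex.I + 1)⁻¹).re := hi.re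
  refine ⟨hi1.add hi2, ?_⟩
  have hz := integral_re hi
  simp only [RCLike.re_to_complex] at hz
  rw [integral_add hi1 hi2, integral_const_mul, integral_univ_inv_one_add_sq]
  rw [hz, h0]
  simp [mul_comm]

end HalfPlane

/-! ### Transfer functions as rational functions and as functions of s. -/

section Transfer

variable {n p m : ℕ}

/-- The value `C (s I - A)⁻¹ B` of the transfer function. -/
noncomputable def freq (x : Triple n p m) (s : ℂ) : Matrix (Fin p) (Fin m) ℂ :=
  x.2.2.map (algebraMap ℝ ℂ) * res x.1 s * x.2.1.map (algebraMap ℝ ℂ)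

/-- The polynomial matrix `C adj(X I - A) B`. -/
noncomputable def transferNum (x : Triple n p m) : Matrix (Fin p) (Fin m) (Polynomial ℝ) :=
  x.2.2.map Polynomial.C * x.1.charmatrix.adjugate * x.2.1.map Polynomial.C

theorem map_charmatrix (A : Matrix (Fin n) (Fin n) ℝ) :
    (RatFunc.X : RatFunc ℝ) • (1 : Matrix (Fin n) (Fin n) (RatFunc ℝ)) - A.map RatFunc.C
      = A.charmatrix.map (algebraMap (Polynomial ℝ) (RatFunc ℝ)) := by
  ext i j
  by_cases h : i = j
  · subst h
    simp [Matrix.charmatrix_apply_eq]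
  · simp [Matrix.charmatrix_apply_ne _ _ _ h, Matrix.one_apply_ne h]

theorem transfer_apply (x : Triple n p m) (i : Fin p) (j : Fin m) :
    transfer x i j = algebraMap (Polynomial ℝ) (RatFunc ℝ) (transferNum x i j)
      / algebraMap (Polynomial ℝ) (RatFunc ℝ) x.1.charpoly := by
  set φ := algebraMap (Polynomial ℝ) (RatFunc ℝ)
  have hC : ∀ {a b : ℕ} (M : Matrix (Fin a) (Fin b) ℝ),
      M.map RatFunc.C = (M.map Polynomial.C).map φ := by
    intro a b M
    ext i j
    simp [φ]
  have hdet : (x.1.charmatrix.map φ).det = φ x.1.charpoly :=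
    (RingHom.map_det φ _).symm
  have hadj : (x.1.charmatrix.map φ).adjugate = x.1.charmatrix.adjugate.map φ :=
    (RingHom.map_adjugate φ _).symm
  rw [transfer, map_charmatrix, Matrix.inv_def, hdet, hadj, Ring.inverse_eq_inv', hC, hC,
    Matrix.mul_smul, Matrix.smul_mul, ← Matrix.map_mul, ← Matrix.map_mul, Matrix.smul_apply,
    Matrix.map_apply, smul_eq_mul, inv_mul_eq_div]
  rfl

theorem aeval_transferNum (x : Triple n p m) (s : ℂ)
    (i : Fin p) (j : Fin m) :
    Polynomial.aeval s (transferNum x i j) / Polynomial.aeval s x.1.charpoly = freq x s i j := by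
  set ψ : Polynomial ℝ →+* ℂ := (Polynomial.aeval s : Polynomial ℝ →ₐ[ℝ] ℂ).toRingHom with hψ
  have hC : ∀ {a b : ℕ} (M : Matrix (Fin a) (Fin b) ℝ),
      (M.map Polynomial.C).map ψ = M.map (algebraMap ℝ ℂ) := by
    intro a b M
    ext i j
    simp [ψ]
  have hchar : x.1.charmatrix.map ψ = pencil x.1 s := by
    ext i j
    by_cases h : i = j
    · subst h
      simp [Matrix.charmatrix_apply_eq, pencil, ψ]
    · simp [Matrix.charmatrix_apply_ne _ _ _ h, Matrix.one_apply_ne h, pencil, ψ]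
  have hadj : x.1.charmatrix.adjugate.map ψ = (pencil x.1 s).adjugate := by
    rw [← hchar]
    exact RingHom.map_adjugate ψ _
  have hnum : (transferNum x).map ψ
      = x.2.2.map (algebraMap ℝ ℂ) * (pencil x.1 s).adjugate * x.2.1.map (algebraMap ℝ ℂ) := by
    rw [transferNum, Matrix.map_mul, Matrix.map_mul, hC, hC, hadj]
  have hij := congrFun (congrFun hnum i) j
  rw [Matrix.map_apply] at hij
  have e : Polynomial.aeval s (transferNum x i j) = ψ (transferNum x i j) := rfl
  rw [e, hij, ← det_pencil, freq, res, Matrix.inv_def, Ring.inverse_eq_inv', Matrix.mul_smul,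
    Matrix.smul_mul, Matrix.smul_apply, smul_eq_mul, inv_mul_eq_div]

/-- `RatFunc.eval` works with the reduced fraction. Its denominator divides b, so it does not vanish
at s and evaluation is multiplicative there. -/
theorem ratFunc_eval_div {a b : Polynomial ℝ} {s : ℂ} (hb : Polynomial.aeval s b ≠ 0) :
    RatFunc.eval (algebraMap ℝ ℂ) s (algebraMap (Polynomial ℝ) (RatFunc ℝ) a
      / algebraMap (Polynomial ℝ) (RatFunc ℝ) b)
      = Polynomial.aeval s a / Polynomial.aeval s b := by
  have hb0 : b ≠ 0 := by
    rintro rfl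
    simp at hb
  set y := algebraMap (Polynomial ℝ) (RatFunc ℝ) a / algebraMap (Polynomial ℝ) (RatFunc ℝ) b
  have hy : Polynomial.eval₂ (algebraMap ℝ ℂ) s y.denom ≠ 0 := by
    intro h0
    obtain ⟨c, hc⟩ := (RatFunc.denom_dvd hb0).2 ⟨a, rfl⟩
    apply hb
    rw [hc, map_mul, Polynomial.aeval_def, h0, zero_mul]
  have hmul : y * algebraMap (Polynomial ℝ) (RatFunc ℝ) b
      = algebraMap (Polynomial ℝ) (RatFunc ℝ) a :=
    div_mul_cancel₀ _ (RatFunc.algebraMap_ne_zero hb0)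
  have := congrArg (RatFunc.eval (algebraMap ℝ ℂ) s) hmul
  rw [RatFunc.eval_mul _ _ hy (by simp), RatFunc.eval_algebraMap, RatFunc.eval_algebraMap] at this
  rw [eq_div_iff hb]
  exact this

theorem evalAt_transfer (x : Triple n p m) {s : ℂ} (h : (pencil x.1 s).det ≠ 0) :
    evalAt (transfer x) s = freq x s := by
  ext i j
  rw [evalAt, Matrix.map_apply, transfer_apply, ratFunc_eval_div, aeval_transferNum x s]
  rwa [← det_pencil]

theorem transfer_sub_apply {N : ℕ} (h : Triple N p m) (x : Triple n p m) (i : Fin p) (j : Fin m) :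
    (transfer h - transfer x) i j = algebraMap (Polynomial ℝ) (RatFunc ℝ)
        (transferNum h i j * x.1.charpoly - h.1.charpoly * transferNum x i j)
      / algebraMap (Polynomial ℝ) (RatFunc ℝ) (h.1.charpoly * x.1.charpoly) := by
  rw [Matrix.sub_apply, transfer_apply, transfer_apply, div_sub_div, map_mul, map_sub, map_mul,
    map_mul]
  · exact RatFunc.algebraMap_ne_zero h.1.charpoly_monic.ne_zero
  · exact RatFunc.algebraMap_ne_zero x.1.charpoly_monic.ne_zero

/-- The difference is put over the product of the characteristic polynomials before evaluating,
which bypasses the reduced denominators of the two terms. -/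
theorem evalAt_transfer_sub {N : ℕ} (h : Triple N p m) (x : Triple n p m) {s : ℂ}
    (hh : (pencil h.1 s).det ≠ 0) (hx : (pencil x.1 s).det ≠ 0) :
    evalAt (transfer h - transfer x) s = freq h s - freq x s := by
  ext i j
  rw [Matrix.sub_apply, ← aeval_transferNum h s, ← aeval_transferNum x s]
  rw [det_pencil] at hh hx
  rw [evalAt, Matrix.map_apply, transfer_sub_apply, ratFunc_eval_div, div_sub_div _ _ hh hx]
  · simp
  · rw [map_mul]
    exact mul_ne_zero hh hx

theorem isStable_transfer {x : Triple n p m} (hx : IsHurwitz x.1) : IsStable (transfer x) := by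
  intro i j s hs
  by_contra! hre
  apply hx s hre
  obtain ⟨c, hc⟩ := (RatFunc.denom_dvd x.1.charpoly_monic.ne_zero).2 ⟨_, transfer_apply x i j⟩
  rw [det_pencil, hc, map_mul, hs, zero_mul]

theorem isStable_transfer_sub {N : ℕ} {h : Triple N p m} {x : Triple n p m} (hh : IsHurwitz h.1)
    (hx : IsHurwitz x.1) : IsStable (transfer h - transfer x) := by
  intro i j s hs
  by_contra! hre
  obtain ⟨c, hc⟩ := (RatFunc.denom_dvd
    (mul_ne_zero h.1.charpoly_monic.ne_zero x.1.charpoly_monic.ne_zero)).2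
      ⟨_, transfer_sub_apply h x i j⟩
  have : Polynomial.aeval s (h.1.charpoly * x.1.charpoly) = 0 := by
    rw [hc, map_mul, hs, zero_mul]
  rw [map_mul, ← det_pencil, ← det_pencil] at this
  exact mul_ne_zero (hh s hre) (hx s hre) this

end Transfer

/-! ### Sylvester equations with Hurwitz coefficients. -/

section Sylvester

variable {a b : ℕ}

/-- The Sylvester operator `X ↦ A X + X Mᵀ`, as a linear function of `(A, M)`. -/
noncomputable def sylOp (a b : ℕ) :
    (Matrix (Fin a) (Fin a) ℝ × Matrix (Fin b) (Fin b) ℝ) →L[ℝ]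
      (Matrix (Fin a) (Fin b) ℝ →L[ℝ] Matrix (Fin a) (Fin b) ℝ) :=
  LinearMap.toContinuousLinearMap
    { toFun := fun q => LinearMap.toContinuousLinearMap
        { toFun := fun X => q.1 * X + X * q.2.transpose
          map_add' := fun X Y => by rw [Matrix.mul_add, Matrix.add_mul]; abel
          map_smul' := fun c X => by simp }
      map_add' := fun q r => by
        ext1 X
        simp [Matrix.add_mul, Matrix.mul_add]
        abel
      map_smul' := fun c q => by
        ext1 X
        simp }

theorem sylOp_apply (A : Matrix (Fin a) (Fin a) ℝ) (M : Matrix (Fin b) (Fin b) ℝ)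
    (X : Matrix (Fin a) (Fin b) ℝ) : sylOp a b (A, M) X = A * X + X * M.transpose := rfl

theorem isHurwitz_transpose {A : Matrix (Fin a) (Fin a) ℝ} (hA : IsHurwitz A) :
    IsHurwitz A.transpose := by
  intro s hs
  rw [det_pencil, Matrix.charpoly_transpose, ← det_pencil]
  exact hA s hs

theorem aeval_mul_eq_mul_aeval {A : Matrix (Fin a) (Fin a) ℝ} {M : Matrix (Fin b) (Fin b) ℝ}
    {X : Matrix (Fin a) (Fin b) ℝ} (h : A * X = X * M) (q : Polynomial ℝ) :
    Polynomial.aeval A q * X = X * Polynomial.aeval M q := by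
  have hpow : ∀ k : ℕ, A ^ k * X = X * M ^ k := by
    intro k
    induction k with
    | zero => simp
    | succ k ih => rw [pow_succ, Matrix.mul_assoc, h, ← Matrix.mul_assoc, ih, Matrix.mul_assoc,
        ← pow_succ]
  induction q using Polynomial.induction_on' with
  | add p q hp hq => rw [map_add, map_add, Matrix.add_mul, Matrix.mul_add, hp, hq]
  | monomial k c =>
    rw [Polynomial.aeval_monomial, Polynomial.aeval_monomial, Algebra.algebraMap_eq_smul_one,
      Algebra.algebraMap_eq_smul_one, smul_mul_assoc, smul_mul_assoc, one_mul, one_mul,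
      Matrix.smul_mul, Matrix.mul_smul, hpow]

/-- X intertwines A with -Mᵀ, so by Cayley–Hamilton X times χ_A(-Mᵀ) is zero. The spectra lie on
opposite sides of the imaginary axis, so the two characteristic polynomials are coprime and Bézout
makes χ_A(-Mᵀ) invertible. -/
theorem sylvester_injective {A : Matrix (Fin a) (Fin a) ℝ} {M : Matrix (Fin b) (Fin b) ℝ}
    (hA : IsHurwitz A) (hM : IsHurwitz M) {X : Matrix (Fin a) (Fin b) ℝ}
    (h : A * X + X * M.transpose = 0) : X = 0 := by
  have hAX : A * X = X * (-M.transpose) := by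
    rw [Matrix.mul_neg]
    exact eq_neg_of_add_eq_zero_left h
  have hcop : IsCoprime A.charpoly (-M.transpose).charpoly := by
    rw [Polynomial.isCoprime_iff_aeval_ne_zero_of_isAlgClosed ℝ ℂ]
    intro s
    rw [← det_pencil, ← det_pencil]
    by_cases hs : 0 ≤ s.re
    · exact Or.inl (hA s hs)
    · right
      have e : pencil (-M.transpose) s = -(pencil M.transpose (-s)) := by
        rw [pencil, pencil]
        ext i j
        simp [add_comm]
      rw [e, Matrix.det_neg]
      refine mul_ne_zero (pow_ne_zero _ (by norm_num)) (isHurwitz_transpose hM _ ?_)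
      rw [Complex.neg_re]
      linarith [not_le.1 hs]
  obtain ⟨u, v, huv⟩ := hcop
  have h1 := congrArg (Polynomial.aeval (-M.transpose)) huv
  rw [map_add, map_mul, map_mul, Matrix.aeval_self_charpoly, mul_zero, add_zero, map_one] at h1
  have h2 := aeval_mul_eq_mul_aeval hAX A.charpoly
  rw [Matrix.aeval_self_charpoly, Matrix.zero_mul] at h2
  have hcomm : Polynomial.aeval (-M.transpose) A.charpoly * Polynomial.aeval (-M.transpose) u = 1 := by
    rw [← map_mul, mul_comm, map_mul, h1]
  calc X = X * (Polynomial.aeval (-M.transpose) A.charpoly * Polynomial.aeval (-M.transpose) u) := by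
        rw [hcomm, Matrix.mul_one]
    _ = 0 := by rw [← Matrix.mul_assoc, ← h2, Matrix.zero_mul]

theorem exists_equiv_sylOp {A : Matrix (Fin a) (Fin a) ℝ} {M : Matrix (Fin b) (Fin b) ℝ}
    (hA : IsHurwitz A) (hM : IsHurwitz M) :
    ∃ e : Matrix (Fin a) (Fin b) ℝ ≃L[ℝ] Matrix (Fin a) (Fin b) ℝ,
      (e : Matrix (Fin a) (Fin b) ℝ →L[ℝ] Matrix (Fin a) (Fin b) ℝ) = sylOp a b (A, M) := by
  have hinj : Function.Injective (sylOp a b (A, M)).toLinearMap := by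
    rw [← LinearMap.ker_eq_bot, LinearMap.ker_eq_bot']
    intro X hX
    exact sylvester_injective hA hM hX
  refine ⟨(LinearEquiv.ofInjectiveEndo _ hinj).toContinuousLinearEquiv, ?_⟩
  ext1 X
  rfl

/-- The solution `X` of the Sylvester equation `A X + X Mᵀ + F = 0`. -/
noncomputable def syl (A : Matrix (Fin a) (Fin a) ℝ) (M : Matrix (Fin b) (Fin b) ℝ)
    (F : Matrix (Fin a) (Fin b) ℝ) : Matrix (Fin a) (Fin b) ℝ :=
  ContinuousLinearMap.inverse (sylOp a b (A, M)) (-F)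

theorem syl_spec {A : Matrix (Fin a) (Fin a) ℝ} {M : Matrix (Fin b) (Fin b) ℝ}
    (hA : IsHurwitz A) (hM : IsHurwitz M) (F : Matrix (Fin a) (Fin b) ℝ) :
    A * syl A M F + syl A M F * M.transpose + F = 0 := by
  obtain ⟨e, he⟩ := exists_equiv_sylOp hA hM
  rw [← sylOp_apply, syl, ← he, ContinuousLinearMap.inverse_equiv]
  simp

theorem eq_syl {A : Matrix (Fin a) (Fin a) ℝ} {M : Matrix (Fin b) (Fin b) ℝ}
    (hA : IsHurwitz A) (hM : IsHurwitz M) {F X : Matrix (Fin a) (Fin b) ℝ}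
    (h : A * X + X * M.transpose + F = 0) : X = syl A M F := by
  rw [← sub_eq_zero]
  refine sylvester_injective hA hM ?_
  have h2 := syl_spec hA hM F
  rw [Matrix.mul_sub, Matrix.sub_mul]
  have : A * X - A * syl A M F + (X * M.transpose - syl A M F * M.transpose)
      = (A * X + X * M.transpose + F)
        - (A * syl A M F + syl A M F * M.transpose + F) := by abel
  rw [this, h, h2, sub_zero]

theorem transpose_syl {A : Matrix (Fin a) (Fin a) ℝ} {M : Matrix (Fin b) (Fin b) ℝ}
    (hA : IsHurwitz A) (hM : IsHurwitz M) (F : Matrix (Fin a) (Fin b) ℝ) :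
    (syl A M F).transpose = syl M A F.transpose := by
  refine eq_syl hM hA ?_
  have h := congrArg Matrix.transpose (syl_spec hA hM F)
  rw [Matrix.transpose_add, Matrix.transpose_add, Matrix.transpose_mul, Matrix.transpose_mul,
    Matrix.transpose_transpose, Matrix.transpose_zero] at h
  rw [← h]
  abel

/-- Inversion of continuous linear maps is smooth at invertible maps, and the Sylvester operator is
linear in its coefficients. -/
theorem contDiffAt_syl {E : Type*} [NormedAddCommGroup E] [NormedSpace ℝ E] {k : WithTop ℕ∞}
    {A : E → Matrix (Fin a) (Fin a) ℝ} {M : E → Matrix (Fin b) (Fin b) ℝ}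
    {F : E → Matrix (Fin a) (Fin b) ℝ} {y : E} (hA : ContDiffAt ℝ k A y)
    (hM : ContDiffAt ℝ k M y) (hF : ContDiffAt ℝ k F y) (hAy : IsHurwitz (A y))
    (hMy : IsHurwitz (M y)) : ContDiffAt ℝ k (fun z => syl (A z) (M z) (F z)) y := by
  obtain ⟨e, he⟩ := exists_equiv_sylOp hAy hMy
  have h1 : ContDiffAt ℝ k (fun z => sylOp a b (A z, M z)) y :=
    (sylOp a b).contDiff.contDiffAt.comp y (hA.prodMk hM)
  have h2 : ContDiffAt ℝ k (fun z => ContinuousLinearMap.inverse (sylOp a b (A z, M z))) y := by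
    have h3 : ContDiffAt ℝ k ContinuousLinearMap.inverse (sylOp a b (A y, M y)) := by
      rw [← he]
      exact contDiffAt_map_inverse e
    exact h3.comp y h1
  exact h2.clm_apply hF.neg

end Sylvester

/-! ### Differentiation of matrix products, transposes and traces. -/

section MatrixCalculus

variable {a b c : ℕ}

/-- Matrix multiplication as a continuous bilinear map. -/
noncomputable def mulBilin (a b c : ℕ) :
    Matrix (Fin a) (Fin b) ℝ →L[ℝ] Matrix (Fin b) (Fin c) ℝ →L[ℝ] Matrix (Fin a) (Fin c) ℝ :=
  LinearMap.toContinuousLinearMap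
    { toFun := fun X => LinearMap.toContinuousLinearMap
        { toFun := fun Y => X * Y
          map_add' := fun Y Z => Matrix.mul_add _ _ _
          map_smul' := fun c Y => Matrix.mul_smul _ _ _ }
      map_add' := fun X Y => by
        ext1 Z
        exact Matrix.add_mul X Y Z
      map_smul' := fun r X => by
        ext1 Z
        exact Matrix.smul_mul r X Z }

/-- Transposition as a continuous linear map. -/
noncomputable def transposeCLM (a b : ℕ) :
    Matrix (Fin a) (Fin b) ℝ →L[ℝ] Matrix (Fin b) (Fin a) ℝ :=
  LinearMap.toContinuousLinearMap (Matrix.transposeLinearEquiv (Fin a) (Fin b) ℝ ℝ).toLinearMap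

/-- The trace as a continuous linear map. -/
noncomputable def traceCLM (a : ℕ) : Matrix (Fin a) (Fin a) ℝ →L[ℝ] ℝ :=
  LinearMap.toContinuousLinearMap (Matrix.traceLinearMap (Fin a) ℝ ℝ)

variable {E : Type*} [NormedAddCommGroup E] [NormedSpace ℝ E] {k : WithTop ℕ∞} {y : E}

theorem contDiffAt_matrix_mul {F : E → Matrix (Fin a) (Fin b) ℝ} {G : E → Matrix (Fin b) (Fin c) ℝ}
    (hF : ContDiffAt ℝ k F y) (hG : ContDiffAt ℝ k G y) :
    ContDiffAt ℝ k (fun z => F z * G z) y :=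
  (((mulBilin a b c).contDiff.contDiffAt.comp y hF).clm_apply hG :)

theorem contDiffAt_matrix_transpose {F : E → Matrix (Fin a) (Fin b) ℝ} (hF : ContDiffAt ℝ k F y) :
    ContDiffAt ℝ k (fun z => (F z).transpose) y :=
  ((transposeCLM a b).contDiff.contDiffAt.comp y hF :)

theorem contDiffAt_matrix_trace {F : E → Matrix (Fin a) (Fin a) ℝ} (hF : ContDiffAt ℝ k F y) :
    ContDiffAt ℝ k (fun z => (F z).trace) y :=
  ((traceCLM a).contDiff.contDiffAt.comp y hF :)

theorem hasDerivAt_matrix_mul {F : ℝ → Matrix (Fin a) (Fin b) ℝ} {G : ℝ → Matrix (Fin b) (Fin c) ℝ}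
    {F' : Matrix (Fin a) (Fin b) ℝ} {G' : Matrix (Fin b) (Fin c) ℝ} {t : ℝ}
    (hF : HasDerivAt F F' t) (hG : HasDerivAt G G' t) :
    HasDerivAt (fun z => F z * G z) (F' * G t + F t * G') t :=
  (((mulBilin a b c).hasFDerivAt.comp_hasDerivAt t hF).clm_apply hG :)

theorem hasDerivAt_matrix_transpose {F : ℝ → Matrix (Fin a) (Fin b) ℝ}
    {F' : Matrix (Fin a) (Fin b) ℝ} {t : ℝ} (hF : HasDerivAt F F' t) :
    HasDerivAt (fun z => (F z).transpose) F'.transpose t :=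
  ((transposeCLM a b).hasFDerivAt.comp_hasDerivAt t hF :)

theorem hasDerivAt_matrix_trace {F : ℝ → Matrix (Fin a) (Fin a) ℝ}
    {F' : Matrix (Fin a) (Fin a) ℝ} {t : ℝ} (hF : HasDerivAt F F' t) :
    HasDerivAt (fun z => (F z).trace) F'.trace t :=
  ((traceCLM a).hasFDerivAt.comp_hasDerivAt t hF :)

end MatrixCalculus

/-! ### Mixed Gramians and the H₂ inner product. -/

section InnerProduct

variable {N n p m : ℕ}

/-- The solution of `A X + X Âᵀ + B B̂ᵀ = 0`, the mixed controllability Gramian. -/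
noncomputable def ctrbGram (h : Triple N p m) (x : Triple n p m) : Matrix (Fin N) (Fin n) ℝ :=
  syl h.1 x.1 (h.2.1 * x.2.1.transpose)

/-- The solution of `Aᵀ Y + Y Â + Cᵀ Ĉ = 0`, the mixed observability Gramian. -/
noncomputable def obsvGram (h : Triple N p m) (x : Triple n p m) : Matrix (Fin N) (Fin n) ℝ :=
  syl h.1.transpose x.1.transpose (h.2.2.transpose * x.2.2)

/-- The `H₂` inner product of two stable transfer functions in terms of realizations. -/
noncomputable def ip (h : Triple N p m) (x : Triple n p m) : ℝ :=
  (h.2.2 * ctrbGram h x * x.2.2.transpose).trace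

/-- The squared `H₂` distance of two stable transfer functions in terms of realizations. -/
noncomputable def distSq (h : Triple N p m) (x : Triple n p m) : ℝ :=
  ip h h - 2 * ip h x + ip x x

theorem ctrbGram_spec {h : Triple N p m} {x : Triple n p m} (hh : IsHurwitz h.1)
    (hx : IsHurwitz x.1) : h.1 * ctrbGram h x + ctrbGram h x * x.1.transpose
      + h.2.1 * x.2.1.transpose = 0 :=
  syl_spec hh hx _

theorem obsvGram_spec {h : Triple N p m} {x : Triple n p m} (hh : IsHurwitz h.1)
    (hx : IsHurwitz x.1) : h.1.transpose * obsvGram h x + obsvGram h x * x.1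
      + h.2.2.transpose * x.2.2 = 0 :=
  syl_spec (isHurwitz_transpose hh) (isHurwitz_transpose hx) _

theorem eq_ctrbGram {h : Triple N p m} {x : Triple n p m} (hh : IsHurwitz h.1)
    (hx : IsHurwitz x.1) {X : Matrix (Fin N) (Fin n) ℝ}
    (hX : h.1 * X + X * x.1.transpose + h.2.1 * x.2.1.transpose = 0) : X = ctrbGram h x :=
  eq_syl hh hx hX

theorem eq_obsvGram {h : Triple N p m} {x : Triple n p m} (hh : IsHurwitz h.1)
    (hx : IsHurwitz x.1) {Y : Matrix (Fin N) (Fin n) ℝ}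
    (hY : h.1.transpose * Y + Y * x.1 + h.2.2.transpose * x.2.2 = 0) : Y = obsvGram h x :=
  eq_syl (isHurwitz_transpose hh) (isHurwitz_transpose hx) hY

theorem transpose_ctrbGram {h : Triple N p m} {x : Triple n p m} (hh : IsHurwitz h.1)
    (hx : IsHurwitz x.1) : (ctrbGram h x).transpose = ctrbGram x h := by
  rw [ctrbGram, transpose_syl hh hx, Matrix.transpose_mul, Matrix.transpose_transpose, ctrbGram]

theorem transpose_obsvGram {h : Triple N p m} {x : Triple n p m} (hh : IsHurwitz h.1)
    (hx : IsHurwitz x.1) : (obsvGram h x).transpose = obsvGram x h := by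
  rw [obsvGram, transpose_syl (isHurwitz_transpose hh) (isHurwitz_transpose hx),
    Matrix.transpose_mul, Matrix.transpose_transpose, obsvGram]

theorem ip_comm {h : Triple N p m} {x : Triple n p m} (hh : IsHurwitz h.1)
    (hx : IsHurwitz x.1) : ip h x = ip x h := by
  rw [ip, ← Matrix.trace_transpose, Matrix.transpose_mul, Matrix.transpose_mul,
    transpose_ctrbGram hh hx, Matrix.transpose_transpose, ← Matrix.mul_assoc, ip]

theorem contDiffAt_ctrbGram {E : Type*} [NormedAddCommGroup E] [NormedSpace ℝ E]
    {k : WithTop ℕ∞} {y : E} {h : E → Triple N p m} {x : E → Triple n p m}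
    (hh : ContDiffAt ℝ k h y) (hx : ContDiffAt ℝ k x y) (hhy : IsHurwitz (h y).1)
    (hxy : IsHurwitz (x y).1) : ContDiffAt ℝ k (fun z => ctrbGram (h z) (x z)) y :=
  contDiffAt_syl hh.fst hx.fst
    (contDiffAt_matrix_mul hh.snd.fst (contDiffAt_matrix_transpose hx.snd.fst)) hhy hxy

theorem contDiffAt_obsvGram {E : Type*} [NormedAddCommGroup E] [NormedSpace ℝ E]
    {k : WithTop ℕ∞} {y : E} {h : E → Triple N p m} {x : E → Triple n p m}
    (hh : ContDiffAt ℝ k h y) (hx : ContDiffAt ℝ k x y) (hhy : IsHurwitz (h y).1)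
    (hxy : IsHurwitz (x y).1) : ContDiffAt ℝ k (fun z => obsvGram (h z) (x z)) y :=
  contDiffAt_syl (contDiffAt_matrix_transpose hh.fst) (contDiffAt_matrix_transpose hx.fst)
    (contDiffAt_matrix_mul (contDiffAt_matrix_transpose hh.snd.snd) hx.snd.snd)
    (isHurwitz_transpose hhy) (isHurwitz_transpose hxy)

theorem contDiffAt_ip {E : Type*} [NormedAddCommGroup E] [NormedSpace ℝ E]
    {k : WithTop ℕ∞} {y : E} {h : E → Triple N p m} {x : E → Triple n p m}
    (hh : ContDiffAt ℝ k h y) (hx : ContDiffAt ℝ k x y) (hhy : IsHurwitz (h y).1)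
    (hxy : IsHurwitz (x y).1) : ContDiffAt ℝ k (fun z => ip (h z) (x z)) y :=
  contDiffAt_matrix_trace (contDiffAt_matrix_mul
    (contDiffAt_matrix_mul hh.snd.snd (contDiffAt_ctrbGram hh hx hhy hxy))
    (contDiffAt_matrix_transpose hx.snd.snd))

theorem contDiffAt_distSq {E : Type*} [NormedAddCommGroup E] [NormedSpace ℝ E]
    {k : WithTop ℕ∞} {y : E} {h : E → Triple N p m} {x : E → Triple n p m}
    (hh : ContDiffAt ℝ k h y) (hx : ContDiffAt ℝ k x y) (hhy : IsHurwitz (h y).1)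
    (hxy : IsHurwitz (x y).1) : ContDiffAt ℝ k (fun z => distSq (h z) (x z)) y :=
  ((contDiffAt_ip hh hh hhy hhy).sub (contDiffAt_const.mul (contDiffAt_ip hh hx hhy hxy))).add
    (contDiffAt_ip hx hx hxy hxy)

end InnerProduct

/-! ### The frequency integral equals the Gramian formula. -/

section Norm

variable {N n p m : ℕ}

theorem conjTranspose_map_algebraMap {a b : ℕ} (M : Matrix (Fin a) (Fin b) ℝ) :
    (M.map (algebraMap ℝ ℂ)).conjTranspose = M.transpose.map (algebraMap ℝ ℂ) := by
  ext i j
  simp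

/-- The integral over the imaginary axis of the real part of the inner product of two transfer
matrices. -/
theorem integral_freq {h : Triple N p m} {x : Triple n p m} (hh : IsHurwitz h.1)
    (hx : IsHurwitz x.1) :
    Integrable (fun y : ℝ =>
      ((freq x (y * Complex.I)).conjTranspose * freq h (y * Complex.I)).trace.re) ∧
    ∫ y : ℝ, ((freq x (y * Complex.I)).conjTranspose * freq h (y * Complex.I)).trace.re
      = 2 * Real.pi * ip h x := by
  set X := ctrbGram h x with hX
  obtain ⟨i1, e1⟩ := integral_re_trace_res hh (X * x.2.2.transpose * h.2.2)
  obtain ⟨i2, e2⟩ := integral_re_trace_res hx (X.transpose * h.2.2.transpose * x.2.2)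
  have key : ∀ y : ℝ,
      ((freq x (y * Complex.I)).conjTranspose * freq h (y * Complex.I)).trace.re
      = (res h.1 (y * Complex.I)
          * (X * x.2.2.transpose * h.2.2).map (algebraMap ℝ ℂ)).trace.re
        + (res x.1 (y * Complex.I)
          * (X.transpose * h.2.2.transpose * x.2.2).map (algebraMap ℝ ℂ)).trace.re := by
    intro y
    set s : ℂ := y * Complex.I with hs
    have hsre : 0 ≤ s.re := by simp [hs]
    have hdh := hh s hsre
    have hdx := hx s hsre
    have hconj : (pencil x.1 s).conjTranspose
        = -(s • (1 : Matrix (Fin n) (Fin n) ℂ)) - x.1.transpose.map (algebraMap ℝ ℂ) := by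
      rw [pencil, Matrix.conjTranspose_sub, conjTranspose_map_algebraMap,
        Matrix.conjTranspose_smul, Matrix.conjTranspose_one, ← neg_smul]
      congr 2
      simp [hs]
    -- On the imaginary axis the conjugate transpose of sI - Â is -sI - Âᵀ, so the Sylvester
    -- equation writes B B̂ᵀ as (sI - A) X + X (sI - Â)ᴴ. This acts as a partial fraction expansion:
    -- the product of two resolvents splits into single resolvents, each integrated by
    -- `integral_re_trace_res`.
    have hsylv : (h.2.1.map (algebraMap ℝ ℂ)) * (x.2.1.transpose.map (algebraMap ℝ ℂ))
        = pencil h.1 s * X.map (algebraMap ℝ ℂ)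
          + X.map (algebraMap ℝ ℂ) * (pencil x.1 s).conjTranspose := by
      have h1 := congrArg (fun M => M.map (algebraMap ℝ ℂ)) (ctrbGram_spec hh hx)
      simp only [Matrix.map_add _ (map_add (algebraMap ℝ ℂ)), Matrix.map_mul,
        Matrix.map_zero _ (map_zero (algebraMap ℝ ℂ))] at h1
      rw [← hX] at h1
      rw [hconj, pencil, Matrix.sub_mul, Matrix.mul_sub, Matrix.smul_mul, Matrix.one_mul,
        Matrix.mul_neg, Matrix.mul_smul, Matrix.mul_one]
      rw [← sub_eq_zero, ← h1]
      abel
    have hresx : (pencil x.1 s).conjTranspose * (res x.1 s).conjTranspose = 1 := by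
      rw [← Matrix.conjTranspose_mul, res_mul_pencil _ hdx, Matrix.conjTranspose_one]
    have hprod : res h.1 s * ((h.2.1.map (algebraMap ℝ ℂ)) *
        (x.2.1.transpose.map (algebraMap ℝ ℂ))) * (res x.1 s).conjTranspose
        = X.map (algebraMap ℝ ℂ) * (res x.1 s).conjTranspose + res h.1 s * X.map (algebraMap ℝ ℂ) := by
      rw [hsylv, Matrix.mul_add, Matrix.add_mul, ← Matrix.mul_assoc, res_mul_pencil _ hdh,
        Matrix.one_mul, Matrix.mul_assoc, Matrix.mul_assoc, hresx, Matrix.mul_one]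
    have hmain : ((freq x s).conjTranspose * freq h s).trace
        = (h.2.2.map (algebraMap ℝ ℂ) * (res h.1 s * ((h.2.1.map (algebraMap ℝ ℂ)) *
        (x.2.1.transpose.map (algebraMap ℝ ℂ))) * (res x.1 s).conjTranspose)
          * x.2.2.transpose.map (algebraMap ℝ ℂ)).trace := by
      rw [Matrix.trace_mul_comm, freq, freq, Matrix.conjTranspose_mul, Matrix.conjTranspose_mul,
        conjTranspose_map_algebraMap, conjTranspose_map_algebraMap]
      simp only [Matrix.mul_assoc]
    rw [hmain, hprod, Matrix.mul_add, Matrix.add_mul, Matrix.trace_add, Complex.add_re, add_comm]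
    congr 1
    · rw [Matrix.trace_mul_comm, ← Matrix.mul_assoc, Matrix.trace_mul_comm]
      simp only [Matrix.map_mul, Matrix.mul_assoc]
    -- The real part is unchanged by conjugation, which turns the adjoint resolvent of Â into the
    -- resolvent itself.
    · rw [← Complex.conj_re, starRingEnd_apply, ← Matrix.trace_conjTranspose]
      simp only [Matrix.conjTranspose_mul, conjTranspose_map_algebraMap,
        Matrix.conjTranspose_conjTranspose, Matrix.transpose_transpose, Matrix.map_mul]
      rw [Matrix.trace_mul_comm]
      simp only [Matrix.mul_assoc]
  simp_rw [key]
  refine ⟨i1.add i2, ?_⟩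
  rw [integral_add i1 i2, e1, e2]
  have t1 : (X * x.2.2.transpose * h.2.2).trace = ip h x := by
    rw [Matrix.trace_mul_comm, ← Matrix.mul_assoc, ip]
  have t2 : (X.transpose * h.2.2.transpose * x.2.2).trace = ip h x := by
    rw [← t1, ← Matrix.trace_transpose]
    simp only [Matrix.transpose_mul, Matrix.transpose_transpose]
    rw [← Matrix.mul_assoc, Matrix.trace_mul_comm, ← Matrix.mul_assoc, Matrix.trace_mul_comm,
      ← Matrix.mul_assoc]
  rw [t1, t2]
  ring

end Norm

/-! ### The H₂ error in terms of realizations. -/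

section ErrorFunction

variable {N n p m : ℕ}

theorem re_trace_conjTranspose_mul_self_nonneg {a b : ℕ} (M : Matrix (Fin a) (Fin b) ℂ) :
    0 ≤ (M.conjTranspose * M).trace.re := by
  rw [Matrix.trace, Complex.re_sum]
  refine Finset.sum_nonneg fun j _ => ?_
  rw [Matrix.diag_apply, Matrix.mul_apply, Complex.re_sum]
  refine Finset.sum_nonneg fun i _ => ?_
  rw [Matrix.conjTranspose_apply, Complex.star_def, Complex.conj_mul', ← Complex.ofReal_pow,
    Complex.ofReal_re]
  positivity

theorem integral_freq_sub {h : Triple N p m} {x : Triple n p m} (hh : IsHurwitz h.1)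
    (hx : IsHurwitz x.1) :
    Integrable (fun y : ℝ => ((freq h (y * Complex.I) - freq x (y * Complex.I)).conjTranspose
      * (freq h (y * Complex.I) - freq x (y * Complex.I))).trace.re) ∧
    ∫ y : ℝ, ((freq h (y * Complex.I) - freq x (y * Complex.I)).conjTranspose
      * (freq h (y * Complex.I) - freq x (y * Complex.I))).trace.re
      = 2 * Real.pi * distSq h x := by
  obtain ⟨i1, e1⟩ := integral_freq hh hh
  obtain ⟨i2, e2⟩ := integral_freq hh hx
  obtain ⟨i3, e3⟩ := integral_freq hx hh
  obtain ⟨i4, e4⟩ := integral_freq hx hx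
  have key : ∀ y : ℝ, ((freq h (y * Complex.I) - freq x (y * Complex.I)).conjTranspose
      * (freq h (y * Complex.I) - freq x (y * Complex.I))).trace.re
      = (((freq h (y * Complex.I)).conjTranspose * freq h (y * Complex.I)).trace.re
        - ((freq x (y * Complex.I)).conjTranspose * freq h (y * Complex.I)).trace.re)
        - (((freq h (y * Complex.I)).conjTranspose * freq x (y * Complex.I)).trace.re
        - ((freq x (y * Complex.I)).conjTranspose * freq x (y * Complex.I)).trace.re) := by
    intro y
    rw [Matrix.conjTranspose_sub, Matrix.mul_sub, Matrix.sub_mul, Matrix.sub_mul,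
      Matrix.trace_sub, Matrix.trace_sub, Matrix.trace_sub]
    simp only [Complex.sub_re]
  simp_rw [key]
  refine ⟨(i1.sub i2).sub (i3.sub i4), ?_⟩
  refine (integral_sub (i1.sub i2) (i3.sub i4)).trans ?_
  rw [integral_sub' i1 i2, integral_sub' i3 i4, e1, e2, e3, e4,
    ← ip_comm hh hx, distSq]
  ring

theorem distSq_nonneg {h : Triple N p m} {x : Triple n p m} (hh : IsHurwitz h.1)
    (hx : IsHurwitz x.1) : 0 ≤ distSq h x := by
  have h1 : 0 ≤ 2 * Real.pi * distSq h x := by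
    rw [← (integral_freq_sub hh hx).2]
    exact integral_nonneg fun y => re_trace_conjTranspose_mul_self_nonneg _
  exact nonneg_of_mul_nonneg_right h1 (by positivity)

theorem h2NormSq_transfer_sub {h : Triple N p m} {x : Triple n p m} (hh : IsHurwitz h.1)
    (hx : IsHurwitz x.1) :
    h2NormSq (transfer h - transfer x) = ENNReal.ofReal (distSq h x) := by
  obtain ⟨hi, he⟩ := integral_freq_sub hh hx
  rw [h2NormSq, if_pos (isStable_transfer_sub hh hx)]
  have key : ∀ y : ℝ, evalAt (transfer h - transfer x) (Complex.I * y)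
      = freq h (y * Complex.I) - freq x (y * Complex.I) := by
    intro y
    rw [mul_comm, evalAt_transfer_sub h x (hh _ (by simp)) (hx _ (by simp))]
  simp_rw [key]
  rw [← ofReal_integral_eq_lintegral_ofReal hi
    (Filter.Eventually.of_forall fun y => re_trace_conjTranspose_mul_self_nonneg _), he,
    ENNReal.ofReal_mul (by positivity), mul_comm, ENNReal.mul_div_cancel_right]
  · simp [Real.pi_pos]
  · exact ENNReal.ofReal_ne_top

theorem errorFn_transfer {h : Triple N p m} {x : Triple n p m} (hh : IsHurwitz h.1)
    (hx : IsHurwitz x.1) : errorFn (transfer h) x = distSq h x := by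
  rw [errorFn, h2NormSq_transfer_sub hh hx, ENNReal.toReal_ofReal (distSq_nonneg hh hx)]

theorem isOpen_setOf_isHurwitz_fst : IsOpen {x : Triple n p m | IsHurwitz x.1} :=
  isOpen_isHurwitz.preimage continuous_fst

/-- Agreement on a neighborhood lets every derivative of the error be computed from the smooth
function `distSq h`. -/
theorem eventuallyEq_errorFn {h : Triple N p m} {x : Triple n p m} (hh : IsHurwitz h.1)
    (hx : IsHurwitz x.1) : errorFn (transfer h) =ᶠ[𝓝 x] distSq h := by
  filter_upwards [isOpen_setOf_isHurwitz_fst.mem_nhds hx] with y hy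
  exact errorFn_transfer hh hy

end ErrorFunction

/-! ### The gradient and the first order conditions. -/

section Gradient

variable {N n p m : ℕ}

/-- The derivative of the `H₂` inner product with respect to the second realization. -/
noncomputable def ipDeriv (h : Triple N p m) (x v : Triple n p m) : ℝ :=
  (h.2.2 * ctrbGram h x * v.2.2.transpose).trace
    + ((obsvGram h x).transpose
        * (h.2.1 * v.2.1.transpose + ctrbGram h x * v.1.transpose)).trace

/-- The observability Gramian solves the adjoint equation, so a trace of an unknown Sylvester
solution X becomes a pairing with its right-hand side F. This eliminates the derivative of the
Gramian from the gradient. -/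
theorem trace_sylvester_duality {h : Triple N p m} {x : Triple n p m} (hh : IsHurwitz h.1)
    (hx : IsHurwitz x.1) {X F : Matrix (Fin N) (Fin n) ℝ}
    (hX : h.1 * X + X * x.1.transpose + F = 0) :
    (h.2.2 * X * x.2.2.transpose).trace = ((obsvGram h x).transpose * F).trace := by
  set Y := obsvGram h x with hY
  have h1 : Y.transpose * h.1 + x.1.transpose * Y.transpose + x.2.2.transpose * h.2.2 = 0 := by
    have := congrArg Matrix.transpose (obsvGram_spec hh hx)
    simpa [Matrix.transpose_add, Matrix.transpose_mul] using this
  have h2 : F = -(h.1 * X + X * x.1.transpose) := (neg_eq_of_add_eq_zero_right hX).symm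
  have h3 : x.2.2.transpose * h.2.2 = -(Y.transpose * h.1 + x.1.transpose * Y.transpose) :=
    (neg_eq_of_add_eq_zero_right h1).symm
  rw [Matrix.trace_mul_comm, ← Matrix.mul_assoc, h3, h2, Matrix.neg_mul, Matrix.mul_neg,
    Matrix.trace_neg, Matrix.trace_neg, Matrix.add_mul, Matrix.mul_add, Matrix.trace_add,
    Matrix.trace_add, Matrix.mul_assoc, Matrix.mul_assoc, Matrix.trace_mul_comm x.1.transpose,
    Matrix.mul_assoc]

theorem hasDerivAt_ip_line {h : Triple N p m} {x : Triple n p m} (hh : IsHurwitz h.1)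
    (hx : IsHurwitz x.1) (u : Triple N p m) (v : Triple n p m) :
    HasDerivAt (fun t : ℝ => ip (h + t • u) (x + t • v)) (ipDeriv h x v + ipDeriv x h u) 0 := by
  have hline : ∀ {a b : ℕ} (M M' : Matrix (Fin a) (Fin b) ℝ),
      HasDerivAt (fun t : ℝ => M + t • M') M' 0 := by
    intro a b M M'
    simpa using ((hasDerivAt_id (0 : ℝ)).smul_const M').const_add M
  have hline' : ∀ {a b : ℕ} (y w : Triple a p m), ContDiffAt ℝ 1 (fun t : ℝ => y + t • w) 0 :=
    fun y w => by fun_prop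
  have hd : DifferentiableAt ℝ (fun t : ℝ => ctrbGram (h + t • u) (x + t • v)) 0 :=
    (contDiffAt_ctrbGram (k := 1) (hline' (b := 0) h u) (hline' (b := 0) x v) (by simpa using hh)
      (by simpa using hx)).differentiableAt one_ne_zero
  set X := ctrbGram h x with hX
  set X' := deriv (fun t : ℝ => ctrbGram (h + t • u) (x + t • v)) 0
  have hX' := hd.hasDerivAt
  have hX0 : ctrbGram (h + (0 : ℝ) • u) (x + (0 : ℝ) • v) = X := by simp [hX]
  have hrel := ((hasDerivAt_matrix_mul (hline h.1 u.1) hX').add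
    (hasDerivAt_matrix_mul hX' (hasDerivAt_matrix_transpose (hline x.1 v.1)))).add
    (hasDerivAt_matrix_mul (hline h.2.1 u.2.1) (hasDerivAt_matrix_transpose (hline x.2.1 v.2.1)))
  have hzero : HasDerivAt (fun _ : ℝ => (0 : Matrix (Fin N) (Fin n) ℝ)) 0 0 := hasDerivAt_const _ _
  have hev : ∀ᶠ t : ℝ in 𝓝 0, IsHurwitz (h + t • u).1 ∧ IsHurwitz (x + t • v).1 := by
    have c1 : Continuous fun t : ℝ => (h + t • u).1 := by fun_prop
    have c2 : Continuous fun t : ℝ => (x + t • v).1 := by fun_prop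
    exact (c1.continuousAt.eventually (isOpen_isHurwitz.mem_nhds (by simpa using hh))).and
      (c2.continuousAt.eventually (isOpen_isHurwitz.mem_nhds (by simpa using hx)))
  -- Differentiating the Sylvester equation along the line shows that X' solves one with the same
  -- coefficients at t = 0. The equation is available only while both matrices stay Hurwitz, that
  -- is, for t near 0.
  have huniq := hrel.unique (hzero.congr_of_eventuallyEq (by
    filter_upwards [hev] with t ht
    exact ctrbGram_spec ht.1 ht.2))
  have hip := hasDerivAt_matrix_trace (hasDerivAt_matrix_mul
    (hasDerivAt_matrix_mul (hline h.2.2 u.2.2) hX') (hasDerivAt_matrix_transpose (hline x.2.2 v.2.2)))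
  rw [hX0] at huniq hip
  simp only [zero_smul, add_zero] at huniq hip
  have hdual := trace_sylvester_duality hh hx (X := X')
    (F := u.1 * X + X * v.1.transpose + (u.2.1 * x.2.1.transpose + h.2.1 * v.2.1.transpose)) (by
      rw [← huniq]; abel)
  refine HasDerivAt.congr_deriv hip ?_
  rw [Matrix.add_mul, Matrix.trace_add, Matrix.trace_add, hdual, ipDeriv, ipDeriv,
    ← transpose_ctrbGram hh hx, ← transpose_obsvGram hh hx, ← hX, Matrix.transpose_transpose]
  set Y := obsvGram h x
  have t1 : (u.2.2 * X * x.2.2.transpose).trace = (x.2.2 * X.transpose * u.2.2.transpose).trace := by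
    rw [← Matrix.trace_transpose]
    simp [Matrix.transpose_mul, Matrix.mul_assoc]
  have t2 : (Y * (x.2.1 * u.2.1.transpose)).trace
      = (Y.transpose * (u.2.1 * x.2.1.transpose)).trace := by
    rw [← Matrix.trace_transpose, Matrix.trace_mul_comm Y.transpose]
    simp [Matrix.transpose_mul]
  have t3 : (Y * (X.transpose * u.1.transpose)).trace
      = (Y.transpose * (u.1 * X)).trace := by
    rw [← Matrix.trace_transpose, Matrix.trace_mul_comm Y.transpose]
    simp [Matrix.transpose_mul]
  simp only [Matrix.mul_add, Matrix.trace_add, t1, t2, t3]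
  ring

theorem differentiableAt_distSq {h : Triple N p m} {x : Triple n p m} (hh : IsHurwitz h.1)
    (hx : IsHurwitz x.1) : DifferentiableAt ℝ (distSq h) x :=
  (contDiffAt_distSq (k := 1) (h := fun _ => h) (x := fun z => z) contDiffAt_const contDiffAt_id
    hh hx).differentiableAt one_ne_zero

theorem fderiv_distSq {h : Triple N p m} {x : Triple n p m} (hh : IsHurwitz h.1)
    (hx : IsHurwitz x.1) (v : Triple n p m) :
    fderiv ℝ (distSq h) x v = 2 * (ipDeriv x x v - ipDeriv h x v) := by
  have h1 : HasDerivAt (fun t : ℝ => distSq h (x + t • v)) (fderiv ℝ (distSq h) x v) 0 := by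
    have hl : HasDerivAt (fun t : ℝ => x + t • v) v 0 := by
      simpa using ((hasDerivAt_id (0 : ℝ)).smul_const v).const_add x
    have hf : HasFDerivAt (distSq h) (fderiv ℝ (distSq h) x) (x + (0 : ℝ) • v) := by
      simpa using (differentiableAt_distSq hh hx).hasFDerivAt
    exact hf.comp_hasDerivAt 0 hl
  have d1 := hasDerivAt_ip_line hh hx 0 v
  -- Both arguments move together, so this term contributes twice `ipDeriv x x v`.
  have d2 := hasDerivAt_ip_line hx hx v v
  have d0 : ipDeriv x h 0 = 0 := by simp [ipDeriv]
  simp only [smul_zero, add_zero, d0] at d1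
  have h2 := ((hasDerivAt_const (0 : ℝ) (ip h h)).sub (d1.const_mul 2)).add d2
  rw [h1.unique h2]
  ring

theorem matrix_eq_zero_of_trace_mul_transpose {a b : ℕ} {D : Matrix (Fin a) (Fin b) ℝ}
    (h : (D * D.transpose).trace = 0) : D = 0 := by
  rw [← Matrix.conjTranspose_eq_transpose_of_trivial] at h
  exact Matrix.trace_mul_conjTranspose_self_eq_zero_iff.1 h

/-- The first order optimality conditions in terms of Gramians. -/
theorem hasFDerivAt_distSq_zero_iff {h : Triple N p m} {x : Triple n p m} (hh : IsHurwitz h.1)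
    (hx : IsHurwitz x.1) :
    HasFDerivAt (distSq h) (0 : Triple n p m →L[ℝ] ℝ) x ↔
      h.2.2 * ctrbGram h x = x.2.2 * ctrbGram x x ∧
      (obsvGram h x).transpose * h.2.1 = (obsvGram x x).transpose * x.2.1 ∧
      (obsvGram h x).transpose * ctrbGram h x = (obsvGram x x).transpose * ctrbGram x x := by
  have hdiff : ∀ v, ipDeriv x x v - ipDeriv h x v
      = ((x.2.2 * ctrbGram x x - h.2.2 * ctrbGram h x) * v.2.2.transpose).trace
      + (((obsvGram x x).transpose * x.2.1 - (obsvGram h x).transpose * h.2.1)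
          * v.2.1.transpose).trace
      + (((obsvGram x x).transpose * ctrbGram x x - (obsvGram h x).transpose * ctrbGram h x)
          * v.1.transpose).trace := by
    intro v
    simp only [ipDeriv, Matrix.sub_mul, Matrix.mul_add, Matrix.trace_add, Matrix.trace_sub,
      Matrix.mul_assoc]
    ring
  constructor
  · intro h0
    have hz : ∀ v, ipDeriv x x v - ipDeriv h x v = 0 := by
      intro v
      have := fderiv_distSq hh hx v
      rw [h0.fderiv] at this
      simpa using this.symm
    simp_rw [hdiff] at hz
    refine ⟨?_, ?_, ?_⟩
    -- Testing with the gradient component itself gives tr(D Dᵀ) = 0; the other two components are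
    -- treated alike.
    · have := hz (0, 0, x.2.2 * ctrbGram x x - h.2.2 * ctrbGram h x)
      simp only [Matrix.transpose_zero, Matrix.mul_zero, Matrix.trace_zero, add_zero] at this
      exact (sub_eq_zero.1 (matrix_eq_zero_of_trace_mul_transpose this)).symm
    · have := hz (0, (obsvGram x x).transpose * x.2.1 - (obsvGram h x).transpose * h.2.1, 0)
      simp only [Matrix.transpose_zero, Matrix.mul_zero, Matrix.trace_zero, add_zero,
        zero_add] at this
      exact (sub_eq_zero.1 (matrix_eq_zero_of_trace_mul_transpose this)).symm
    · have := hz ((obsvGram x x).transpose * ctrbGram x x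
        - (obsvGram h x).transpose * ctrbGram h x, 0, 0)
      simp only [Matrix.transpose_zero, Matrix.mul_zero, Matrix.trace_zero, add_zero,
        zero_add] at this
      exact (sub_eq_zero.1 (matrix_eq_zero_of_trace_mul_transpose this)).symm
  · rintro ⟨h1, h2, h3⟩
    have hf : fderiv ℝ (distSq h) x = 0 := by
      refine ContinuousLinearMap.ext fun v => ?_
      rw [fderiv_distSq hh hx, hdiff, h1, h2, h3]
      simp
    rw [← hf]
    exact (differentiableAt_distSq hh hx).hasFDerivAt

end Gradient

/-! ### Minimal triples and invertibility of their Gramians. -/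

section Minimality

variable {n p m : ℕ}

theorem rank_eq_iff_det_ne_zero (M : Matrix (Fin n) (Fin n) ℝ) : M.rank = n ↔ M.det ≠ 0 := by
  constructor
  · intro h
    have hr : LinearMap.range M.mulVecLin = ⊤ := by
      apply Submodule.eq_top_of_finrank_eq
      rw [← Matrix.rank, h]
      simp
    have hs : Function.Surjective M.mulVec := LinearMap.range_eq_top.1 hr
    have := (Matrix.isUnit_iff_isUnit_det M).1 (Matrix.mulVec_surjective_iff_isUnit.1 hs)
    exact this.ne_zero
  · intro h
    simpa using Matrix.rank_of_isUnit M
      ((Matrix.isUnit_iff_isUnit_det M).2 (isUnit_iff_ne_zero.2 h))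

/-- Nonvanishing of Gram determinants is visibly an open condition, and inverting these Gram
matrices yields one-sided inverses of the controllability and observability matrices. -/
theorem isMinimal_iff_det (x : Triple n p m) :
    IsMinimal x ↔ (ctrbMatrix x * (ctrbMatrix x).transpose).det ≠ 0
      ∧ ((obsvMatrix x).transpose * obsvMatrix x).det ≠ 0 := by
  rw [← rank_eq_iff_det_ne_zero, ← rank_eq_iff_det_ne_zero, Matrix.rank_self_mul_transpose,
    Matrix.rank_transpose_mul_self, IsMinimal]

theorem continuous_ctrbMatrix : Continuous (ctrbMatrix : Triple n p m → _) := by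
  refine continuous_pi fun i => continuous_pi fun kj => ?_
  have : Continuous fun x : Triple n p m => x.1 ^ (kj.1 : ℕ) * x.2.1 := by fun_prop
  exact this.matrix_elem i kj.2

theorem continuous_obsvMatrix : Continuous (obsvMatrix : Triple n p m → _) := by
  refine continuous_pi fun ki => continuous_pi fun j => ?_
  have : Continuous fun x : Triple n p m => x.2.2 * x.1 ^ (ki.1 : ℕ) := by fun_prop
  exact this.matrix_elem ki.2 j

theorem isOpen_isMinimal : IsOpen {x : Triple n p m | IsMinimal x} := by
  simp_rw [isMinimal_iff_det]
  refine IsOpen.inter ?_ ?_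
  · exact isOpen_ne.preimage
      (continuous_ctrbMatrix.matrix_mul continuous_ctrbMatrix.matrix_transpose).matrix_det
  · exact isOpen_ne.preimage
      (continuous_obsvMatrix.matrix_transpose.matrix_mul continuous_obsvMatrix).matrix_det

theorem exists_ctrbMatrix_mul_eq_one {x : Triple n p m} (hx : IsMinimal x) :
    ∃ M : Matrix (Fin n × Fin m) (Fin n) ℝ, ctrbMatrix x * M = 1 := by
  refine ⟨(ctrbMatrix x).transpose * (ctrbMatrix x * (ctrbMatrix x).transpose)⁻¹, ?_⟩
  rw [← Matrix.mul_assoc]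
  exact Matrix.mul_nonsing_inv _ (isUnit_iff_ne_zero.2 ((isMinimal_iff_det x).1 hx).1)

theorem exists_mul_obsvMatrix_eq_one {x : Triple n p m} (hx : IsMinimal x) :
    ∃ M : Matrix (Fin n) (Fin n × Fin p) ℝ, M * obsvMatrix x = 1 := by
  refine ⟨((obsvMatrix x).transpose * obsvMatrix x)⁻¹ * (obsvMatrix x).transpose, ?_⟩
  rw [Matrix.mul_assoc]
  exact Matrix.nonsing_inv_mul _ (isUnit_iff_ne_zero.2 ((isMinimal_iff_det x).1 hx).2)

/-- The dual triple `(Aᵀ, Cᵀ, Bᵀ)`. -/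
def dual (x : Triple n p m) : Triple n m p :=
  (x.1.transpose, x.2.2.transpose, x.2.1.transpose)

theorem ctrbMatrix_dual (x : Triple n p m) : ctrbMatrix (dual x) = (obsvMatrix x).transpose := by
  ext i kj
  simp [ctrbMatrix, obsvMatrix, dual, ← Matrix.transpose_pow, ← Matrix.transpose_mul]

theorem obsvMatrix_dual (x : Triple n p m) : obsvMatrix (dual x) = (ctrbMatrix x).transpose := by
  ext i kj
  simp [ctrbMatrix, obsvMatrix, dual, ← Matrix.transpose_pow, ← Matrix.transpose_mul]

theorem isMinimal_dual {x : Triple n p m} (hx : IsMinimal x) : IsMinimal (dual x) := by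
  rw [IsMinimal, ctrbMatrix_dual, obsvMatrix_dual, Matrix.rank_transpose, Matrix.rank_transpose]
  exact ⟨hx.2, hx.1⟩

theorem obsvGram_eq_ctrbGram_dual {N : ℕ} (h : Triple N p m) (x : Triple n p m) :
    obsvGram h x = ctrbGram (dual h) (dual x) := by
  simp [obsvGram, ctrbGram, dual]

theorem eq_zero_of_vecMul_eq_zero {x : Triple n p m} (hx : IsMinimal x) {v : Fin n → ℝ}
    (hv : ∀ k : ℕ, Matrix.vecMul v (x.1 ^ k * x.2.1) = 0) : v = 0 := by
  obtain ⟨M, hM⟩ := exists_ctrbMatrix_mul_eq_one hx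
  have h0 : Matrix.vecMul v (ctrbMatrix x) = 0 := by
    ext kj
    exact congrFun (hv kj.1) kj.2
  rw [← Matrix.vecMul_one v, ← hM, ← Matrix.vecMul_vecMul, h0, Matrix.zero_vecMul]

/-- The controllability Gramian of a stable minimal triple is invertible. -/
theorem isUnit_det_ctrbGram {x : Triple n p m} (hx : IsMinimal x) (hA : IsHurwitz x.1) :
    IsUnit (ctrbGram x x).det := by
  set P := ctrbGram x x with hP
  have hsymm : P.transpose = P := transpose_ctrbGram hA hA
  have hspec := ctrbGram_spec hA hA
  rw [← hP] at hspec
  -- The kernel of P is Aᵀ-invariant and annihilated by Bᵀ: pairing the Lyapunov equation with v in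
  -- the kernel leaves |Bᵀ v|² = 0. Hence v is orthogonal to every Aᵏ B, so controllability makes it
  -- zero.
  have step : ∀ v : Fin n → ℝ, P.mulVec v = 0 →
      x.2.1.transpose.mulVec v = 0 ∧ P.mulVec (x.1.transpose.mulVec v) = 0 := by
    intro v hv
    have h1 := congrArg (fun M => Matrix.mulVec M v) hspec
    simp only [Matrix.add_mulVec, ← Matrix.mulVec_mulVec, hv, Matrix.mulVec_zero, zero_add,
      Matrix.zero_mulVec] at h1
    have h2 := congrArg (fun w => v ⬝ᵥ w) h1
    simp only [dotProduct_add, dotProduct_zero] at h2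
    rw [Matrix.dotProduct_mulVec, ← Matrix.mulVec_transpose, hsymm, hv, zero_dotProduct, zero_add,
      Matrix.dotProduct_mulVec, ← Matrix.mulVec_transpose, dotProduct_self_eq_zero] at h2
    refine ⟨h2, ?_⟩
    rwa [h2, Matrix.mulVec_zero, add_zero] at h1
  rw [isUnit_iff_ne_zero]
  intro h0
  obtain ⟨v, hv0, hv⟩ := Matrix.exists_mulVec_eq_zero_iff.2 h0
  apply hv0
  have hk : ∀ k : ℕ, P.mulVec ((x.1 ^ k).transpose.mulVec v) = 0 := by
    intro k
    induction k with
    | zero => simpa using hv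
    | succ k ih =>
      have := (step _ ih).2
      rwa [Matrix.mulVec_mulVec _ x.1.transpose, ← Matrix.transpose_mul, ← pow_succ] at this
  refine eq_zero_of_vecMul_eq_zero hx fun k => ?_
  rw [← Matrix.mulVec_transpose, Matrix.transpose_mul, ← Matrix.mulVec_mulVec]
  exact (step _ (hk k)).1

theorem isUnit_det_obsvGram {x : Triple n p m} (hx : IsMinimal x) (hA : IsHurwitz x.1) :
    IsUnit (obsvGram x x).det := by
  rw [obsvGram_eq_ctrbGram_dual]
  exact isUnit_det_ctrbGram (isMinimal_dual hx) (isHurwitz_transpose hA)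

end Minimality

/-! ### Similarity of minimal realizations and the quotient map. -/

section Similarity

variable {n p m : ℕ}

/-- The similarity action `(A, B, C) ↦ (T A T⁻¹, T B, C T⁻¹)`. -/
noncomputable def act (T : Matrix (Fin n) (Fin n) ℝ) (x : Triple n p m) : Triple n p m :=
  (T * x.1 * T⁻¹, T * x.2.1, x.2.2 * T⁻¹)

theorem act_pow {T : Matrix (Fin n) (Fin n) ℝ} (hT : IsUnit T.det) (A : Matrix (Fin n) (Fin n) ℝ)
    (k : ℕ) : (T * A * T⁻¹) ^ k = T * A ^ k * T⁻¹ := by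
  induction k with
  | zero => rw [pow_zero, pow_zero, Matrix.mul_one, Matrix.mul_nonsing_inv _ hT]
  | succ k ih =>
    rw [pow_succ, ih, pow_succ]
    calc T * A ^ k * T⁻¹ * (T * A * T⁻¹) = T * A ^ k * (T⁻¹ * T) * A * T⁻¹ := by
          simp only [Matrix.mul_assoc]
      _ = T * (A ^ k * A) * T⁻¹ := by
          rw [Matrix.nonsing_inv_mul _ hT, Matrix.mul_one]; simp only [Matrix.mul_assoc]

theorem ctrbMatrix_act {T : Matrix (Fin n) (Fin n) ℝ} (hT : IsUnit T.det) (x : Triple n p m) :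
    ctrbMatrix (act T x) = T * ctrbMatrix x := by
  ext i kj
  have : (act T x).1 ^ (kj.1 : ℕ) * (act T x).2.1 = T * (x.1 ^ (kj.1 : ℕ) * x.2.1) := by
    rw [act, act_pow hT, Matrix.mul_assoc, ← Matrix.mul_assoc T⁻¹, Matrix.nonsing_inv_mul _ hT,
      Matrix.one_mul, Matrix.mul_assoc]
  rw [ctrbMatrix, Matrix.of_apply, this]
  rfl

theorem obsvMatrix_act {T : Matrix (Fin n) (Fin n) ℝ} (hT : IsUnit T.det) (x : Triple n p m) :
    obsvMatrix (act T x) = obsvMatrix x * T⁻¹ := by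
  ext ki j
  have : (act T x).2.2 * (act T x).1 ^ (ki.1 : ℕ) = x.2.2 * x.1 ^ (ki.1 : ℕ) * T⁻¹ := by
    rw [act, act_pow hT]
    calc x.2.2 * T⁻¹ * (T * x.1 ^ (ki.1 : ℕ) * T⁻¹)
        = x.2.2 * (T⁻¹ * T) * x.1 ^ (ki.1 : ℕ) * T⁻¹ := by simp only [Matrix.mul_assoc]
      _ = _ := by rw [Matrix.nonsing_inv_mul _ hT, Matrix.mul_one]
  rw [obsvMatrix, Matrix.of_apply, this]
  rfl

theorem isMinimal_act {T : Matrix (Fin n) (Fin n) ℝ} (hT : IsUnit T.det) {x : Triple n p m}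
    (hx : IsMinimal x) : IsMinimal (act T x) := by
  rw [IsMinimal, ctrbMatrix_act hT, obsvMatrix_act hT,
    Matrix.rank_mul_eq_right_of_isUnit_det _ _ hT,
    Matrix.rank_mul_eq_left_of_isUnit_det _ _ (Matrix.isUnit_nonsing_inv_det _ hT)]
  exact hx

theorem transfer_act {T : Matrix (Fin n) (Fin n) ℝ} (hT : IsUnit T.det) (x : Triple n p m) :
    transfer (act T x) = transfer x := by
  have hTT : T.map RatFunc.C * T⁻¹.map RatFunc.C = 1 := by
    rw [← Matrix.map_mul, Matrix.mul_nonsing_inv _ hT]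
    simp
  have hinv : (T.map RatFunc.C)⁻¹ = T⁻¹.map RatFunc.C := Matrix.inv_eq_right_inv hTT
  have hinv' : (T⁻¹.map RatFunc.C)⁻¹ = T.map RatFunc.C := Matrix.inv_eq_left_inv hTT
  have hTT' : T⁻¹.map RatFunc.C * T.map RatFunc.C = 1 := by
    rw [← Matrix.map_mul, Matrix.nonsing_inv_mul _ hT]
    simp
  have hpen : (RatFunc.X : RatFunc ℝ) • (1 : Matrix (Fin n) (Fin n) (RatFunc ℝ))
        - (T * x.1 * T⁻¹).map RatFunc.C = T.map RatFunc.C *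
        ((RatFunc.X : RatFunc ℝ) • (1 : Matrix (Fin n) (Fin n) (RatFunc ℝ))
        - x.1.map RatFunc.C) * T⁻¹.map RatFunc.C := by
    rw [Matrix.mul_sub, Matrix.sub_mul, Matrix.mul_smul, Matrix.mul_one, Matrix.smul_mul, hTT,
      Matrix.map_mul, Matrix.map_mul]
  rw [transfer, act, hpen, Matrix.mul_inv_rev, Matrix.mul_inv_rev, hinv, hinv', transfer,
    Matrix.map_mul, Matrix.map_mul]
  set R := ((RatFunc.X : RatFunc ℝ) • (1 : Matrix (Fin n) (Fin n) (RatFunc ℝ))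
        - x.1.map RatFunc.C)⁻¹
  calc x.2.2.map RatFunc.C * T⁻¹.map RatFunc.C * (T.map RatFunc.C * (R * T⁻¹.map RatFunc.C))
        * (T.map RatFunc.C * x.2.1.map RatFunc.C)
      = x.2.2.map RatFunc.C * (T⁻¹.map RatFunc.C * T.map RatFunc.C) * R
        * (T⁻¹.map RatFunc.C * T.map RatFunc.C) * x.2.1.map RatFunc.C := by
        simp only [Matrix.mul_assoc]
    _ = _ := by rw [hTT', Matrix.mul_one, Matrix.mul_one]

/-- Multiplication by s splits off the constant C B and replaces C by C A. This serves twice: at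
infinity to read off Markov parameters, and near a finite point to pass from C to all C Aʲ. -/
theorem smul_freq (x : Triple n p m) {s : ℂ} (hs : (pencil x.1 s).det ≠ 0) :
    s • freq x s = (x.2.2 * x.2.1).map (algebraMap ℝ ℂ)
      + freq ((x.1, x.2.1, x.2.2 * x.1) : Triple n p m) s := by
  rw [freq, ← Matrix.smul_mul, ← Matrix.mul_smul, smul_res _ hs, Matrix.mul_add, Matrix.mul_one,
    Matrix.add_mul, freq, Matrix.map_mul, Matrix.map_mul]
  simp only [Matrix.mul_assoc]

theorem smul_freq' (x : Triple n p m) {s : ℂ} (hs : (pencil x.1 s).det ≠ 0) :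
    s • freq x s = (x.2.2 * x.2.1).map (algebraMap ℝ ℂ)
      + freq ((x.1, x.1 * x.2.1, x.2.2) : Triple n p m) s := by
  have h1 : s • res x.1 s = 1 + res x.1 s * x.1.map (algebraMap ℝ ℂ) := by
    have := res_mul_pencil x.1 hs
    rw [pencil, mul_sub, mul_smul_comm, mul_one, sub_eq_iff_eq_add] at this
    exact this
  rw [freq, ← Matrix.smul_mul, ← Matrix.mul_smul, h1, Matrix.mul_add, Matrix.mul_one,
    Matrix.add_mul, freq, Matrix.map_mul, Matrix.map_mul]
  simp only [Matrix.mul_assoc]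

theorem tendsto_freq (x : Triple n p m) :
    Filter.Tendsto (freq x) (Bornology.cobounded ℂ) (𝓝 0) := by
  have hc : Continuous fun M : Matrix (Fin n) (Fin n) ℂ =>
      x.2.2.map (algebraMap ℝ ℂ) * M * x.2.1.map (algebraMap ℝ ℂ) := by fun_prop
  have := (hc.tendsto 0).comp (tendsto_res x.1)
  rwa [Matrix.mul_zero, Matrix.zero_mul] at this

/-- Since s G(s) tends to C B at infinity, G determines C B; removing that term leaves the transfer
function with C A in place of C, and induction gives every C Aᵏ B. -/
theorem markov_eq_of_eventually_freq_eq {n' : ℕ} (k : ℕ) :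
    ∀ (x : Triple n p m) (y : Triple n' p m),
      (∀ᶠ s in Bornology.cobounded ℂ, freq x s = freq y s) →
        x.2.2 * x.1 ^ k * x.2.1 = y.2.2 * y.1 ^ k * y.2.1 := by
  have hbase : ∀ (x : Triple n p m) (y : Triple n' p m),
      (∀ᶠ s in Bornology.cobounded ℂ, freq x s = freq y s) → x.2.2 * x.2.1 = y.2.2 * y.2.1 ∧
      ∀ᶠ s in Bornology.cobounded ℂ, freq ((x.1, x.2.1, x.2.2 * x.1) : Triple n p m) s
        = freq ((y.1, y.2.1, y.2.2 * y.1) : Triple n' p m) s := by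
    intro x y hxy
    have hev : ∀ᶠ s in Bornology.cobounded ℂ, (x.2.2 * x.2.1).map (algebraMap ℝ ℂ)
        + freq ((x.1, x.2.1, x.2.2 * x.1) : Triple n p m) s
        = (y.2.2 * y.2.1).map (algebraMap ℝ ℂ)
        + freq ((y.1, y.2.1, y.2.2 * y.1) : Triple n' p m) s := by
      filter_upwards [hxy, eventually_det_pencil_ne_zero_cobounded x.1,
        eventually_det_pencil_ne_zero_cobounded y.1] with s h1 h2 h3
      rw [← smul_freq x h2, ← smul_freq y h3, h1]
    have l1 := (tendsto_freq ((x.1, x.2.1, x.2.2 * x.1) : Triple n p m)).const_add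
      ((x.2.2 * x.2.1).map (algebraMap ℝ ℂ))
    have l2 := (tendsto_freq ((y.1, y.2.1, y.2.2 * y.1) : Triple n' p m)).const_add
      ((y.2.2 * y.2.1).map (algebraMap ℝ ℂ))
    have he := tendsto_nhds_unique (l1.congr' hev) l2
    rw [add_zero, add_zero] at he
    refine ⟨Matrix.map_injective Complex.ofReal_injective he, ?_⟩
    filter_upwards [hev] with s hs
    rw [he] at hs
    exact add_left_cancel hs
  induction k with
  | zero =>
    intro x y hxy
    simpa using (hbase x y hxy).1
  | succ k ih =>
    intro x y hxy
    have := ih _ _ (hbase x y hxy).2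
    rw [pow_succ', pow_succ', ← Matrix.mul_assoc, ← Matrix.mul_assoc]
    exact this

theorem markov_eq_of_transfer_eq {n' : ℕ} {x : Triple n p m} {y : Triple n' p m}
    (hxy : transfer x = transfer y) (k : ℕ) :
    x.2.2 * x.1 ^ k * x.2.1 = y.2.2 * y.1 ^ k * y.2.1 := by
  refine markov_eq_of_eventually_freq_eq k x y ?_
  filter_upwards [eventually_det_pencil_ne_zero_cobounded x.1,
        eventually_det_pencil_ne_zero_cobounded y.1] with s h2 h3
  rw [← evalAt_transfer x h2, ← evalAt_transfer y h3, hxy]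

/-- Two minimal triples with the same transfer function are similar. -/
theorem exists_act_eq_of_transfer_eq {x y : Triple n p m} (hx : IsMinimal x) (hy : IsMinimal y)
    (hxy : transfer x = transfer y) : ∃ T : Matrix (Fin n) (Fin n) ℝ, IsUnit T.det ∧ y = act T x := by
  have hmk := markov_eq_of_transfer_eq hxy
  obtain ⟨M, hM⟩ := exists_ctrbMatrix_mul_eq_one hx
  obtain ⟨L, hL⟩ := exists_mul_obsvMatrix_eq_one hx
  obtain ⟨L', hL'⟩ := exists_mul_obsvMatrix_eq_one hy
  -- Both triples factor the same Hankel matrix of Markov parameters; `e1` is the shifted Hankel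
  -- matrix, `e2` and `e3` its first block column and block row.
  have e0 : obsvMatrix x * ctrbMatrix x = obsvMatrix y * ctrbMatrix y := by
    have : ∀ z : Triple n p m, obsvMatrix z * ctrbMatrix z = Matrix.of fun (ki : Fin n × Fin p)
        (lj : Fin n × Fin m) => (z.2.2 * z.1 ^ ((ki.1 : ℕ) + lj.1) * z.2.1) ki.2 lj.2 := by
      intro z
      ext ki lj
      rw [Matrix.of_apply, pow_add, ← Matrix.mul_assoc, Matrix.mul_assoc (z.2.2 * _)]
      rfl
    rw [this, this]
    simp_rw [hmk]
  have e1 : obsvMatrix x * x.1 * ctrbMatrix x = obsvMatrix y * y.1 * ctrbMatrix y := by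
    have : ∀ z : Triple n p m, obsvMatrix z * z.1 * ctrbMatrix z = Matrix.of fun (ki : Fin n × Fin p)
        (lj : Fin n × Fin m) => (z.2.2 * z.1 ^ ((ki.1 : ℕ) + 1 + lj.1) * z.2.1) ki.2 lj.2 := by
      intro z
      ext ki lj
      rw [Matrix.of_apply, pow_add, pow_succ, ← Matrix.mul_assoc, ← Matrix.mul_assoc,
        Matrix.mul_assoc (z.2.2 * _ * _)]
      rfl
    rw [this, this]
    simp_rw [hmk]
  have e2 : obsvMatrix x * x.2.1 = obsvMatrix y * y.2.1 := by
    ext ki j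
    exact congrFun (congrFun (hmk ki.1) ki.2) j
  have e3 : x.2.2 * ctrbMatrix x = y.2.2 * ctrbMatrix y := by
    have : ∀ z : Triple n p m, z.2.2 * ctrbMatrix z = Matrix.of fun (i : Fin p)
        (lj : Fin n × Fin m) => (z.2.2 * z.1 ^ (lj.1 : ℕ) * z.2.1) i lj.2 := by
      intro z
      ext i lj
      rw [Matrix.of_apply, Matrix.mul_assoc]
      rfl
    rw [this, this]
    simp_rw [hmk]
  -- The change of state is found from the observability matrices, and by `e0` also from the
  -- controllability matrices. The first form transports B, the second C, and both together A.
  set T := L' * obsvMatrix x with hT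
  have hT2 : T = ctrbMatrix y * M := by
    calc T = L' * (obsvMatrix x * ctrbMatrix x) * M := by
          rw [Matrix.mul_assoc, Matrix.mul_assoc, hM, Matrix.mul_one]
      _ = ctrbMatrix y * M := by
          rw [e0, ← Matrix.mul_assoc L', hL', Matrix.one_mul]
  have hO : obsvMatrix x = obsvMatrix y * T := by
    rw [hT2, ← Matrix.mul_assoc, ← e0, Matrix.mul_assoc, hM, Matrix.mul_one]
  have hunit : (L * obsvMatrix y) * T = 1 := by
    rw [Matrix.mul_assoc, ← hO, hL]
  have hdet : IsUnit T.det := by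
    have := congrArg Matrix.det hunit
    rw [Matrix.det_mul, Matrix.det_one] at this
    exact IsUnit.of_mul_eq_one_right _ this
  have hB : y.2.1 = T * x.2.1 := by
    calc y.2.1 = L' * obsvMatrix y * y.2.1 := by rw [hL', Matrix.one_mul]
      _ = T * x.2.1 := by rw [Matrix.mul_assoc, ← e2, ← Matrix.mul_assoc]
  have hC : x.2.2 = y.2.2 * T := by
    calc x.2.2 = x.2.2 * (ctrbMatrix x * M) := by rw [hM, Matrix.mul_one]
      _ = y.2.2 * T := by rw [← Matrix.mul_assoc, e3, Matrix.mul_assoc, ← hT2]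
  have hA : T * x.1 = y.1 * T := by
    calc T * x.1 = L' * (obsvMatrix x * x.1 * ctrbMatrix x) * M := by
          rw [Matrix.mul_assoc L' _ M, Matrix.mul_assoc (obsvMatrix x * x.1), hM, Matrix.mul_one,
            hT, Matrix.mul_assoc]
      _ = y.1 * T := by
          rw [e1, Matrix.mul_assoc (obsvMatrix y), ← Matrix.mul_assoc L', hL', Matrix.one_mul,
            Matrix.mul_assoc, ← hT2]
  refine ⟨T, hdet, Prod.ext ?_ (Prod.ext hB ?_)⟩
  · rw [act, hA, Matrix.mul_assoc, Matrix.mul_nonsing_inv _ hdet, Matrix.mul_one]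
  · simp only [act]
    rw [hC, Matrix.mul_assoc, Matrix.mul_nonsing_inv _ hdet, Matrix.mul_one]

theorem continuous_act (T : Matrix (Fin n) (Fin n) ℝ) :
    Continuous (act T : Triple n p m → Triple n p m) := by
  unfold act
  fun_prop

theorem continuous_ofMinimal : Continuous (RatTF.ofMinimal (n := n) (p := p) (m := m)) :=
  continuous_coinduced_rng

theorem act_act_inv {T : Matrix (Fin n) (Fin n) ℝ} (hT : IsUnit T.det) (x : Triple n p m) :
    act T⁻¹ (act T x) = x := by
  have h := Matrix.nonsing_inv_mul _ hT
  refine Prod.ext ?_ (Prod.ext ?_ ?_)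
  · simp only [act]
    rw [Matrix.nonsing_inv_nonsing_inv _ hT]
    calc T⁻¹ * (T * x.1 * T⁻¹) * T = (T⁻¹ * T) * x.1 * (T⁻¹ * T) := by
          simp only [Matrix.mul_assoc]
      _ = x.1 := by rw [h, Matrix.one_mul, Matrix.mul_one]
  · simp only [act]
    rw [← Matrix.mul_assoc, h, Matrix.one_mul]
  · simp only [act]
    rw [Matrix.nonsing_inv_nonsing_inv _ hT, Matrix.mul_assoc, h, Matrix.mul_one]

/-- Fibres are similarity classes and each similarity acts continuously on minimal triples, so the
saturation of an open set is open. -/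
theorem isOpenMap_ofMinimal : IsOpenMap (RatTF.ofMinimal (n := n) (p := p) (m := m)) := by
  intro O hO
  change IsOpen (RatTF.ofMinimal ⁻¹' (RatTF.ofMinimal '' O))
  rw [isOpen_iff_mem_nhds]
  rintro y ⟨x, hxO, hxy⟩
  obtain ⟨T, hT, hyx⟩ := exists_act_eq_of_transfer_eq x.2 y.2 (congrArg Subtype.val hxy)
  have hT' : IsUnit T⁻¹.det := Matrix.isUnit_nonsing_inv_det _ hT
  let f : {x : Triple n p m // IsMinimal x} → {x : Triple n p m // IsMinimal x} :=
    fun z => ⟨act T⁻¹ z.1, isMinimal_act hT' z.2⟩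
  have hf : Continuous f := ((continuous_act T⁻¹).comp continuous_subtype_val).subtype_mk _
  have hfy : f y = x := by
    apply Subtype.ext
    simp only [f, hyx, act_act_inv hT]
  filter_upwards [hf.continuousAt.preimage_mem_nhds (hO.mem_nhds (hfy ▸ hxO))] with z hz
  exact ⟨f z, hz, Subtype.ext (transfer_act hT' z.1)⟩

end Similarity

/-! ### Minimal realizations of stable transfer functions. -/

section Stability

variable {n p m : ℕ}

theorem tendsto_evalAt {E : RatMatrix p m} (hE : IsStable E) {l : ℂ} (hl : 0 ≤ l.re) :
    Filter.Tendsto (evalAt E) (𝓝 l) (𝓝 (evalAt E l)) := by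
  refine tendsto_pi_nhds.2 fun i => tendsto_pi_nhds.2 fun j => ?_
  have hd : Polynomial.eval₂ (algebraMap ℝ ℂ) l (E i j).denom ≠ 0 := fun h0 =>
    absurd (hE i j l h0) (not_lt.2 hl)
  have c1 : ∀ q : Polynomial ℝ, Continuous fun s : ℂ => Polynomial.eval₂ (algebraMap ℝ ℂ) s q :=
    fun q => by
      simp_rw [← Polynomial.eval_map]
      exact Polynomial.continuous _
  exact ((c1 _).continuousAt.div (c1 _).continuousAt hd).tendsto

/-- A minimal realization of a stable transfer function is stable. -/
theorem isHurwitz_of_isStable_transfer {x : Triple n p m} (hx : IsMinimal x)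
    (hs : IsStable (transfer x)) : IsHurwitz x.1 := by
  intro l hl h0
  have hev := eventually_det_pencil_ne_zero_nhdsNE x.1 l
  have hid : Filter.Tendsto (fun s : ℂ => s) (𝓝[≠] l) (𝓝 l) := nhdsWithin_le_nhds
  -- At an eigenvalue l in the closed right half-plane, stability still gives G a finite limit.
  -- Multiplying by s transfers this to all C Aʲ (sI - A)⁻¹ Aᵏ B, and the one-sided inverses
  -- supplied by minimality transfer it to the resolvent itself.
  have base : ∃ F, Filter.Tendsto (freq x) (𝓝[≠] l) (𝓝 F) := by
    refine ⟨_, ((tendsto_evalAt hs hl).mono_left nhdsWithin_le_nhds).congr' ?_⟩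
    filter_upwards [hev] with s h
    exact evalAt_transfer x h
  have stepC : ∀ (B : Matrix (Fin n) (Fin m) ℝ) (C : Matrix (Fin p) (Fin n) ℝ),
      (∃ F, Filter.Tendsto (freq ((x.1, B, C) : Triple n p m)) (𝓝[≠] l) (𝓝 F)) →
      ∃ F, Filter.Tendsto (freq ((x.1, B, C * x.1) : Triple n p m)) (𝓝[≠] l) (𝓝 F) := by
    rintro B C ⟨F, hF⟩
    refine ⟨_, ((hid.smul hF).sub_const ((C * B).map (algebraMap ℝ ℂ))).congr' ?_⟩
    filter_upwards [hev] with s h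
    rw [smul_freq ((x.1, B, C) : Triple n p m) h, add_sub_cancel_left]
  have stepB : ∀ (B : Matrix (Fin n) (Fin m) ℝ) (C : Matrix (Fin p) (Fin n) ℝ),
      (∃ F, Filter.Tendsto (freq ((x.1, B, C) : Triple n p m)) (𝓝[≠] l) (𝓝 F)) →
      ∃ F, Filter.Tendsto (freq ((x.1, x.1 * B, C) : Triple n p m)) (𝓝[≠] l) (𝓝 F) := by
    rintro B C ⟨F, hF⟩
    refine ⟨_, ((hid.smul hF).sub_const ((C * B).map (algebraMap ℝ ℂ))).congr' ?_⟩
    filter_upwards [hev] with s h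
    rw [smul_freq' ((x.1, B, C) : Triple n p m) h, add_sub_cancel_left]
  have hall : ∀ j k : ℕ, ∃ F, Filter.Tendsto
      (freq ((x.1, x.1 ^ k * x.2.1, x.2.2 * x.1 ^ j) : Triple n p m)) (𝓝[≠] l) (𝓝 F) := by
    intro j k
    induction j with
    | zero =>
      induction k with
      | zero => simpa using base
      | succ k ih =>
        rw [pow_succ', Matrix.mul_assoc]
        exact stepB _ _ ih
    | succ j ih =>
      rw [pow_succ, ← Matrix.mul_assoc x.2.2]
      exact stepC _ _ ih
  choose F hF using hall
  have hbig : Filter.Tendsto (fun s => (obsvMatrix x).map (algebraMap ℝ ℂ) * res x.1 s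
      * (ctrbMatrix x).map (algebraMap ℝ ℂ)) (𝓝[≠] l)
      (𝓝 (Matrix.of fun (ki : Fin n × Fin p) (lj : Fin n × Fin m) =>
        F ki.1 lj.1 ki.2 lj.2)) := by
    refine tendsto_pi_nhds.2 fun ki => tendsto_pi_nhds.2 fun lj => ?_
    exact tendsto_pi_nhds.1 (tendsto_pi_nhds.1 (hF ki.1 lj.1) ki.2) lj.2
  obtain ⟨M, hM⟩ := exists_ctrbMatrix_mul_eq_one hx
  obtain ⟨L, hL⟩ := exists_mul_obsvMatrix_eq_one hx
  have hM' : (ctrbMatrix x).map (algebraMap ℝ ℂ) * M.map (algebraMap ℝ ℂ) = 1 := by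
    rw [← Matrix.map_mul, hM]
    simp
  have hL' : L.map (algebraMap ℝ ℂ) * (obsvMatrix x).map (algebraMap ℝ ℂ) = 1 := by
    rw [← Matrix.map_mul, hL]
    simp
  have hc : Continuous fun Z : Matrix (Fin n × Fin p) (Fin n × Fin m) ℂ =>
      L.map (algebraMap ℝ ℂ) * Z * M.map (algebraMap ℝ ℂ) := by fun_prop
  have hres := (hc.tendsto _).comp hbig
  have hres' := hres.congr (f₂ := res x.1) (by
    intro s
    simp only [Function.comp]
    rw [Matrix.mul_assoc, Matrix.mul_assoc, hM', Matrix.mul_one, ← Matrix.mul_assoc, hL',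
      Matrix.one_mul])
  have hdet := (((continuous_id (X := Matrix (Fin n) (Fin n) ℂ)).matrix_det.tendsto _).comp hres')
  have hpen : Filter.Tendsto (fun s => (pencil x.1 s).det) (𝓝[≠] l) (𝓝 0) := by
    rw [← h0]
    exact (((continuous_pencil (n := n)).comp
      (Continuous.prodMk_right x.1)).matrix_det.tendsto l).mono_left nhdsWithin_le_nhds
  -- The product of the two determinants is 1 off the spectrum, but det(sI - A) tends to 0 while the
  -- determinant of the resolvent has a finite limit.
  have hone := hpen.mul hdet
  rw [zero_mul] at hone
  refine zero_ne_one (tendsto_nhds_unique hone (tendsto_const_nhds.congr' ?_))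
  filter_upwards [hev] with s h
  simp only [Function.comp, id]
  rw [← Matrix.det_mul, pencil_mul_res _ h, Matrix.det_one]

end Stability

/-! ### Deforming the target so that a perturbed model stays stationary. -/

section Inflation

variable {N n p m : ℕ}

/-- The triple with `N` states obtained from `h` by replacing its compression to the range of the
projection `V W` by `x`, with coupling blocks determined by `R` and `S`. -/
noncomputable def couple (h : Triple N p m) (V : Matrix (Fin N) (Fin n) ℝ)
    (W : Matrix (Fin n) (Fin N) ℝ) (R S : Matrix (Fin n) (Fin n) ℝ) (x : Triple n p m) :
    Triple N p m :=
  (V * x.1 * W - V * (S * x.2.2.transpose * h.2.2 * (1 - V * W))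
      - (1 - V * W) * h.2.1 * x.2.1.transpose * R * W
      + (1 - V * W) * h.1 * (1 - V * W),
    V * x.2.1 + (1 - V * W) * h.2.1,
    x.2.2 * W + h.2.2 * (1 - V * W))

/-- The coupling for which `x` is stationary. -/
noncomputable def inflate (h : Triple N p m) (V : Matrix (Fin N) (Fin n) ℝ)
    (W : Matrix (Fin n) (Fin N) ℝ) (x : Triple n p m) : Triple N p m :=
  couple h V W (ctrbGram x x)⁻¹ (obsvGram x x)⁻¹ x

/-- The coupling blocks are exactly those for which V P and (Q W)ᵀ solve the mixed Gramian
equations. The first order conditions then collapse to W V = 1, E V = 0 and W E = 0, so the same V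
and W serve every x. -/
theorem hasFDerivAt_distSq_inflate (h : Triple N p m) {V : Matrix (Fin N) (Fin n) ℝ}
    {W : Matrix (Fin n) (Fin N) ℝ} (hWV : W * V = 1) {x : Triple n p m} (hmin : IsMinimal x)
    (hx : IsHurwitz x.1) (hi : IsHurwitz (inflate h V W x).1) :
    HasFDerivAt (distSq (inflate h V W x)) (0 : Triple n p m →L[ℝ] ℝ) x := by
  have hPdet := isUnit_det_ctrbGram hmin hx
  have hQdet := isUnit_det_obsvGram hmin hx
  have hP := ctrbGram_spec hx hx
  have hQ := obsvGram_spec hx hx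
  have hQt : (obsvGram x x).transpose = obsvGram x x := transpose_obsvGram hx hx
  rw [hasFDerivAt_distSq_zero_iff hi hx]
  set P := ctrbGram x x
  set Q := obsvGram x x
  set E := 1 - V * W with hE
  have hEV : E * V = 0 := by
    rw [hE, Matrix.sub_mul, Matrix.one_mul, Matrix.mul_assoc, hWV, Matrix.mul_one, sub_self]
  have hWE : W * E = 0 := by
    rw [hE, Matrix.mul_sub, Matrix.mul_one, ← Matrix.mul_assoc, hWV, Matrix.one_mul, sub_self]
  set g := inflate h V W x with hg
  have g1 : g.1 = V * x.1 * W - V * (Q⁻¹ * x.2.2.transpose * h.2.2 * E)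
      - E * h.2.1 * x.2.1.transpose * P⁻¹ * W + E * h.1 * E := rfl
  have g2 : g.2.1 = V * x.2.1 + E * h.2.1 := rfl
  have g3 : g.2.2 = x.2.2 * W + h.2.2 * E := rfl
  have hAV : g.1 * V = V * x.1 - E * h.2.1 * x.2.1.transpose * P⁻¹ := by
    rw [g1, Matrix.add_mul, Matrix.sub_mul, Matrix.sub_mul, Matrix.mul_assoc (V * x.1), hWV,
      Matrix.mul_one, Matrix.mul_assoc V, Matrix.mul_assoc _ E V, hEV,
      Matrix.mul_assoc _ W V, hWV, Matrix.mul_one, Matrix.mul_assoc (E * h.1), hEV]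
    simp only [Matrix.mul_zero, sub_zero, add_zero]
  have hWA : W * g.1 = x.1 * W - Q⁻¹ * x.2.2.transpose * h.2.2 * E := by
    rw [g1, Matrix.mul_add, Matrix.mul_sub, Matrix.mul_sub]
    simp only [← Matrix.mul_assoc, hWV, hWE, Matrix.one_mul, Matrix.zero_mul, sub_zero, add_zero]
  have hX : V * P = ctrbGram g x := by
    refine eq_ctrbGram hi hx ?_
    calc g.1 * (V * P) + V * P * x.1.transpose + g.2.1 * x.2.1.transpose
        = V * (x.1 * P + P * x.1.transpose + x.2.1 * x.2.1.transpose) := by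
          rw [← Matrix.mul_assoc, hAV, g2, Matrix.sub_mul, Matrix.mul_assoc _ P⁻¹ P,
            Matrix.nonsing_inv_mul _ hPdet]
          simp only [Matrix.mul_add, Matrix.add_mul, Matrix.mul_assoc, Matrix.mul_one]
          abel
      _ = 0 := by rw [hP, Matrix.mul_zero]
  have hY : (Q * W).transpose = obsvGram g x := by
    refine eq_obsvGram hi hx ?_
    have : Q * (W * g.1) + x.1.transpose * (Q * W) + x.2.2.transpose * g.2.2 = 0 := by
      calc Q * (W * g.1) + x.1.transpose * (Q * W) + x.2.2.transpose * g.2.2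
          = (x.1.transpose * Q + Q * x.1 + x.2.2.transpose * x.2.2) * W := by
            rw [hWA, g3, Matrix.mul_sub]
            simp only [← Matrix.mul_assoc, Matrix.mul_nonsing_inv _ hQdet, Matrix.mul_add,
              Matrix.add_mul, Matrix.one_mul]
            abel
        _ = 0 := by rw [hQ, Matrix.zero_mul]
    have h2 := congrArg Matrix.transpose this
    simpa [Matrix.transpose_add, Matrix.transpose_mul, Matrix.mul_assoc] using h2
  rw [← hX, ← hY, Matrix.transpose_transpose, hQt]
  refine ⟨?_, ?_, ?_⟩
  · rw [g3, Matrix.add_mul, ← Matrix.mul_assoc, ← Matrix.mul_assoc, Matrix.mul_assoc x.2.2, hWV,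
      Matrix.mul_assoc h.2.2, hEV, Matrix.mul_one, Matrix.mul_zero, Matrix.zero_mul, add_zero]
  · rw [g2, Matrix.mul_add, Matrix.mul_assoc Q, ← Matrix.mul_assoc W, hWV, Matrix.one_mul,
      Matrix.mul_assoc Q, ← Matrix.mul_assoc W, hWE, Matrix.zero_mul, Matrix.mul_zero, add_zero]
  · rw [Matrix.mul_assoc, ← Matrix.mul_assoc W, hWV, Matrix.one_mul]

/-- At a stationary point, the target is an inflation of the reduced model. -/
theorem exists_inflate_eq {h : Triple N p m} {x : Triple n p m} (hmin : IsMinimal x)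
    (hh : IsHurwitz h.1) (hx : IsHurwitz x.1)
    (hst : HasFDerivAt (distSq h) (0 : Triple n p m →L[ℝ] ℝ) x) :
    ∃ (V : Matrix (Fin N) (Fin n) ℝ) (W : Matrix (Fin n) (Fin N) ℝ),
      W * V = 1 ∧ inflate h V W x = h := by
  have hPdet := isUnit_det_ctrbGram hmin hx
  have hQdet := isUnit_det_obsvGram hmin hx
  have hP := ctrbGram_spec hx hx
  have hQt : (obsvGram x x).transpose = obsvGram x x := transpose_obsvGram hx hx
  have hX := ctrbGram_spec hh hx
  have hY := congrArg Matrix.transpose (obsvGram_spec hh hx)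
  obtain ⟨c1, c2, c3⟩ := (hasFDerivAt_distSq_zero_iff hh hx).1 hst
  rw [hQt] at c2 c3
  simp only [Matrix.transpose_add, Matrix.transpose_mul, Matrix.transpose_transpose,
    Matrix.transpose_zero] at hY
  unfold inflate couple
  set P := ctrbGram x x
  set Q := obsvGram x x
  set X := ctrbGram h x
  set Y := obsvGram h x
  -- The third optimality condition says W V = 1 for this choice; the first two give C V = Ĉ and W B
  -- = B̂.
  obtain ⟨V, hV⟩ : ∃ V, V = X * P⁻¹ := ⟨_, rfl⟩
  obtain ⟨W, hW⟩ : ∃ W, W = Q⁻¹ * Y.transpose := ⟨_, rfl⟩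
  have hVP : V * P = X := by
    rw [hV, Matrix.mul_assoc, Matrix.nonsing_inv_mul _ hPdet, Matrix.mul_one]
  have hQW : Q * W = Y.transpose := by
    rw [hW, ← Matrix.mul_assoc, Matrix.mul_nonsing_inv _ hQdet, Matrix.one_mul]
  have hWV : W * V = 1 := by
    rw [hW, hV, Matrix.mul_assoc, ← Matrix.mul_assoc Y.transpose, c3, Matrix.mul_assoc Q,
      Matrix.mul_nonsing_inv _ hPdet, Matrix.mul_one, Matrix.nonsing_inv_mul _ hQdet]
  refine ⟨V, W, hWV, ?_⟩
  set E := 1 - V * W with hE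
  have hEV : E * V = 0 := by
    rw [hE, Matrix.sub_mul, Matrix.one_mul, Matrix.mul_assoc, hWV, Matrix.mul_one, sub_self]
  have hWE : W * E = 0 := by
    rw [hE, Matrix.mul_sub, Matrix.mul_one, ← Matrix.mul_assoc, hWV, Matrix.one_mul, sub_self]
  have hVWE : V * W + E = 1 := by rw [hE]; abel
  have hWB : W * h.2.1 = x.2.1 := by
    rw [hW, Matrix.mul_assoc, c2, ← Matrix.mul_assoc, Matrix.nonsing_inv_mul _ hQdet,
      Matrix.one_mul]
  have hCV : h.2.2 * V = x.2.2 := by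
    rw [hV, ← Matrix.mul_assoc, c1, Matrix.mul_assoc, Matrix.mul_nonsing_inv _ hPdet,
      Matrix.mul_one]
  have hAV : h.1 * V = -(V * P * x.1.transpose + h.2.1 * x.2.1.transpose) * P⁻¹ := by
    rw [hVP, hV, ← Matrix.mul_assoc]
    congr 1
    rw [eq_neg_iff_add_eq_zero, ← hX]
    abel
  have hWA : W * h.1 = -(Q⁻¹ * (x.1.transpose * (Q * W) + x.2.2.transpose * h.2.2)) := by
    rw [hQW, hW, Matrix.mul_assoc, ← Matrix.mul_neg]
    congr 1
    rw [eq_neg_iff_add_eq_zero, ← hY]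
    abel
  have hWAV : W * h.1 * V = x.1 := by
    rw [Matrix.mul_assoc, hAV, ← Matrix.mul_assoc, Matrix.mul_neg, Matrix.mul_add,
      ← Matrix.mul_assoc W (V * P), ← Matrix.mul_assoc W V, ← Matrix.mul_assoc W h.2.1, hWV, hWB,
      Matrix.one_mul]
    have : x.1 * P = -(P * x.1.transpose + x.2.1 * x.2.1.transpose) := by
      rw [eq_neg_iff_add_eq_zero, ← hP]
      abel
    rw [← this, Matrix.mul_assoc, Matrix.mul_nonsing_inv _ hPdet, Matrix.mul_one]
  have hEAV : E * h.1 * V = -(E * h.2.1 * x.2.1.transpose * P⁻¹) := by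
    rw [Matrix.mul_assoc, hAV, ← Matrix.mul_assoc, Matrix.mul_neg, Matrix.mul_add]
    simp only [← Matrix.mul_assoc, hEV, Matrix.zero_mul, zero_add, Matrix.neg_mul]
  have hWAE : W * h.1 * E = -(Q⁻¹ * x.2.2.transpose * h.2.2 * E) := by
    rw [hWA, Matrix.neg_mul, Matrix.mul_add, Matrix.add_mul]
    simp only [Matrix.mul_assoc, hWE, Matrix.mul_zero, zero_add]
  refine Prod.ext ?_ (Prod.ext ?_ ?_)
  -- A is expanded in its four blocks relative to 1 = V W + E; the Sylvester equations have fixed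
  -- all of them except E A E.
  · change V * x.1 * W - V * (Q⁻¹ * x.2.2.transpose * h.2.2 * E)
      - E * h.2.1 * x.2.1.transpose * P⁻¹ * W + E * h.1 * E = h.1
    calc _ = V * (W * h.1 * V) * W + V * (W * h.1 * E) + E * h.1 * V * W + E * h.1 * E := by
          rw [hWAV, hWAE, hEAV, Matrix.mul_neg, Matrix.neg_mul]
          abel
      _ = (V * W + E) * h.1 * (V * W + E) := by
          simp only [Matrix.mul_add, Matrix.add_mul, Matrix.mul_assoc]
          abel
      _ = h.1 := by rw [hVWE, Matrix.one_mul, Matrix.mul_one]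
  · change V * x.2.1 + E * h.2.1 = h.2.1
    calc _ = (V * W + E) * h.2.1 := by rw [Matrix.add_mul, Matrix.mul_assoc, hWB]
      _ = h.2.1 := by rw [hVWE, Matrix.one_mul]
  · change x.2.2 * W + h.2.2 * E = h.2.2
    calc _ = h.2.2 * (V * W + E) := by rw [Matrix.mul_add, ← Matrix.mul_assoc, hCV]
      _ = h.2.2 := by rw [hVWE, Matrix.mul_one]

theorem continuousAt_matrix_nonsing_inv {X : Type*} [TopologicalSpace X] {a : ℕ}
    {F : X → Matrix (Fin a) (Fin a) ℝ} {y : X} (hF : ContinuousAt F y) (hdet : IsUnit (F y).det) :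
    ContinuousAt (fun z => (F z)⁻¹) y := by
  refine ContinuousAt.comp (g := Inv.inv) (continuousAt_matrix_inv _ ?_) hF
  rw [Ring.inverse_eq_inv']
  exact continuousAt_inv₀ hdet.ne_zero

/-- For fixed h, V and W the map `couple` is polynomial in its remaining arguments, so only the
inverse Gramians need care. -/
theorem continuousAt_inflate (h : Triple N p m) (V : Matrix (Fin N) (Fin n) ℝ)
    (W : Matrix (Fin n) (Fin N) ℝ) {x : Triple n p m} (hmin : IsMinimal x) (hx : IsHurwitz x.1) :
    ContinuousAt (inflate h V W) x := by
  have hP : ContinuousAt (fun z : Triple n p m => (ctrbGram z z)⁻¹) x :=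
    continuousAt_matrix_nonsing_inv (contDiffAt_ctrbGram (k := 1) (h := fun z => z)
      (x := fun z => z) contDiffAt_id contDiffAt_id hx hx).continuousAt (isUnit_det_ctrbGram hmin hx)
  have hQ : ContinuousAt (fun z : Triple n p m => (obsvGram z z)⁻¹) x :=
    continuousAt_matrix_nonsing_inv (contDiffAt_obsvGram (k := 1) (h := fun z => z)
      (x := fun z => z) contDiffAt_id contDiffAt_id hx hx).continuousAt (isUnit_det_obsvGram hmin hx)
  have hc : Continuous fun q : Triple n p m × Matrix (Fin n) (Fin n) ℝ × Matrix (Fin n) (Fin n) ℝ =>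
      couple h V W q.2.1 q.2.2 q.1 := by
    unfold couple
    fun_prop
  exact ContinuousAt.comp (x := x) (hc.continuousAt (x := (x, _, _)))
    (continuousAt_id.prodMk (hP.prodMk hQ))

/-- Stationarity persists under perturbation of the reduced model. -/
theorem exists_stationary_deformation {h : Triple N p m} {x : Triple n p m} (hmin : IsMinimal x)
    (hh : IsHurwitz h.1) (hx : IsHurwitz x.1)
    (hst : HasFDerivAt (distSq h) (0 : Triple n p m →L[ℝ] ℝ) x) :
    ∃ g : Triple n p m → Triple N p m, g x = h ∧ ContinuousAt g x ∧
      ∀ᶠ y in 𝓝 x, HasFDerivAt (distSq (g y)) (0 : Triple n p m →L[ℝ] ℝ) y := by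
  obtain ⟨V, W, hWV, hgh⟩ := exists_inflate_eq hmin hh hx hst
  have hc := continuousAt_inflate h V W hmin hx
  refine ⟨inflate h V W, hgh, hc, ?_⟩
  have h1 := hc.preimage_mem_nhds (isOpen_setOf_isHurwitz_fst.mem_nhds
    (show IsHurwitz (inflate h V W x).1 by rwa [hgh]))
  filter_upwards [h1, isOpen_setOf_isHurwitz_fst.mem_nhds hx, isOpen_isMinimal.mem_nhds hmin]
    with y hy1 hy2 hy3
  exact hasFDerivAt_distSq_inflate h hWV hy3 hy2 hy1

end Inflation

/-! ### Second order conditions in one variable along lines. -/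

section SecondOrder

variable {E : Type*} [NormedAddCommGroup E] [NormedSpace ℝ E]

theorem hasDerivAt_line (x v : E) (t : ℝ) : HasDerivAt (fun t : ℝ => x + t • v) v t := by
  simpa using ((hasDerivAt_id t).smul_const v).const_add x

theorem hasDerivAt_comp_line {f : E → ℝ} {x v : E} {t : ℝ} (hf : DifferentiableAt ℝ f (x + t • v)) :
    HasDerivAt (fun t : ℝ => f (x + t • v)) (fderiv ℝ f (x + t • v) v) t :=
  HasFDerivAt.comp_hasDerivAt (l := f) t hf.hasFDerivAt (hasDerivAt_line x v t)

theorem hasDerivAt_fderiv_comp_line {f : E → ℝ} {x v : E} {t : ℝ}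
    (hf : ContDiffAt ℝ 2 f (x + t • v)) (w : E) :
    HasDerivAt (fun t : ℝ => fderiv ℝ f (x + t • v) w)
      (fderiv ℝ (fderiv ℝ f) (x + t • v) v w) t := by
  have h1 : DifferentiableAt ℝ (fderiv ℝ f) (x + t • v) :=
    (hf.fderiv_right (m := 1) (by norm_num)).differentiableAt one_ne_zero
  have h2 : HasDerivAt (fun t : ℝ => fderiv ℝ f (x + t • v))
      (fderiv ℝ (fderiv ℝ f) (x + t • v) v) t :=
    HasFDerivAt.comp_hasDerivAt (l := fderiv ℝ f) t h1.hasFDerivAt (hasDerivAt_line x v t)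
  simpa using h2.clm_apply (hasDerivAt_const t w)

/-- The second order necessary condition for a local minimum. -/
theorem fderiv_fderiv_nonneg_of_isLocalMin {f : E → ℝ} {x : E} (hf : ContDiffAt ℝ 2 f x)
    (hmin : IsLocalMin f x) (v : E) : 0 ≤ fderiv ℝ (fderiv ℝ f) x v v := by
  by_contra! hneg
  have hx0 : x + (0 : ℝ) • v = x := by simp
  have hline : Filter.Tendsto (fun t : ℝ => x + t • v) (𝓝 0) (𝓝 x) := by
    have := (hasDerivAt_line x v 0).continuousAt.tendsto
    rwa [hx0] at this
  have hC2 : ∀ᶠ t : ℝ in 𝓝 0, ContDiffAt ℝ 2 f (x + t • v) :=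
    hline.eventually (hf.eventually (by simp))
  have hd : deriv (fun t : ℝ => f (x + t • v)) =ᶠ[𝓝 0] fun t => fderiv ℝ f (x + t • v) v := by
    filter_upwards [hC2] with t ht
    exact (hasDerivAt_comp_line (ht.differentiableAt two_ne_zero)).deriv
  have hdd : deriv (deriv fun t : ℝ => f (x + t • v)) 0 = fderiv ℝ (fderiv ℝ f) x v v := by
    rw [hd.deriv_eq, (hasDerivAt_fderiv_comp_line (hx0.symm ▸ hf) v).deriv, hx0]
  have hd0 : deriv (fun t : ℝ => f (x + t • v)) 0 = 0 := by
    rw [hd.self_of_nhds]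
    simp [hmin.fderiv_eq_zero]
  have hcont : ContinuousAt (fun t : ℝ => f (x + t • v)) 0 :=
    (hasDerivAt_comp_line (hx0.symm ▸ hf.differentiableAt two_ne_zero)).continuousAt
  -- A negative second derivative makes 0 a local maximum as well as a local minimum along the line,
  -- so f is constant there and its second derivative vanishes.
  have hmax := isLocalMax_of_deriv_deriv_neg (hdd ▸ hneg) hd0 hcont
  have hconst : (fun t : ℝ => f (x + t • v)) =ᶠ[𝓝 0] fun _ => f x := by
    filter_upwards [hmax, hline.eventually hmin] with t h1 h2
    simp only [hx0] at h1
    exact le_antisymm h1 h2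
  have : deriv (deriv fun t : ℝ => f (x + t • v)) 0 = 0 := by
    rw [hconst.deriv.deriv_eq]
    simp
  rw [hdd] at this
  exact hneg.ne this

/-- For a positive semidefinite symmetric form, isotropic vectors lie in the kernel. -/
theorem form_apply_eq_zero_of_nonneg {B : E →L[ℝ] E →L[ℝ] ℝ} (hsymm : ∀ v w, B v w = B w v)
    (hpos : ∀ v, 0 ≤ B v v) {v : E} (hv : B v v = 0) (w : E) : B v w = 0 := by
  have key : ∀ t : ℝ, 0 ≤ 2 * t * B v w + t ^ 2 * B w w := by
    intro t
    have := hpos (v + t • w)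
    simp only [map_add, map_smul, add_apply, smul_apply,
      smul_eq_mul, hv, hsymm w v] at this
    linarith
  by_contra hne
  have hw := hpos w
  -- A near-minimizer of the quadratic in t; the added 1 keeps the denominator positive when `B w w`
  -- is zero.
  have h1 := key (-(B v w) / (B w w + 1))
  have hpos1 : 0 < B w w + 1 := by linarith
  have h2 : 2 * (-(B v w) / (B w w + 1)) * B v w + (-(B v w) / (B w w + 1)) ^ 2 * B w w
      = -((B v w) ^ 2 * (B w w + 2) / (B w w + 1) ^ 2) := by
    field_simp
    ring
  rw [h2] at h1
  have h3 : 0 < (B v w) ^ 2 * (B w w + 2) / (B w w + 1) ^ 2 := by positivity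
  linarith

/-- A critical point minimizes along a segment on which the second derivative is nonnegative. -/
theorem le_of_fderiv_fderiv_nonneg {f : E → ℝ} {s : Set E} (hs : Convex ℝ s)
    (hf : ∀ y ∈ s, ContDiffAt ℝ 2 f y) {x z : E}
    (hpos : ∀ y ∈ s, 0 ≤ fderiv ℝ (fderiv ℝ f) y z z) (hx : x ∈ s) (hxz : x + z ∈ s)
    (hcrit : fderiv ℝ f x = 0) : f x ≤ f (x + z) := by
  have hmem : ∀ t ∈ Set.Icc (0 : ℝ) 1, x + t • z ∈ s := fun t ht =>
    hs.add_smul_mem hx hxz ht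
  have hd1 : ∀ t ∈ Set.Icc (0 : ℝ) 1, HasDerivAt (fun t : ℝ => f (x + t • z))
      (fderiv ℝ f (x + t • z) z) t := fun t ht =>
    hasDerivAt_comp_line ((hf _ (hmem t ht)).differentiableAt two_ne_zero)
  have hd2 : ∀ t ∈ Set.Icc (0 : ℝ) 1, HasDerivAt (fun t : ℝ => fderiv ℝ f (x + t • z) z)
      (fderiv ℝ (fderiv ℝ f) (x + t • z) z z) t := fun t ht =>
    hasDerivAt_fderiv_comp_line (hf _ (hmem t ht)) z
  -- The mean value theorem is applied to f on [0, 1], then to its directional derivative on [0, c],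
  -- where the derivative at 0 vanishes.
  obtain ⟨c, hc, hce⟩ := exists_hasDerivAt_eq_slope _ _ zero_lt_one
    (fun t ht => (hd1 t ht).continuousAt.continuousWithinAt)
    (fun t ht => hd1 t (Set.Ioo_subset_Icc_self ht))
  have hsub : Set.Icc (0 : ℝ) c ⊆ Set.Icc 0 1 := Set.Icc_subset_Icc_right hc.2.le
  obtain ⟨d, hd, hde⟩ := exists_hasDerivAt_eq_slope _ _ hc.1
    (fun t ht => (hd2 t (hsub ht)).continuousAt.continuousWithinAt)
    (fun t ht => hd2 t (hsub (Set.Ioo_subset_Icc_self ht)))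
  have h2 := hpos _ (hmem d (hsub (Set.Ioo_subset_Icc_self hd)))
  simp only [zero_smul, add_zero, one_smul, sub_zero, div_one, hcrit,
    zero_apply] at hce hde
  rw [hde] at h2
  have h3 : 0 ≤ fderiv ℝ f (x + c • z) z := by
    by_contra! hn
    exact absurd h2 (not_le.2 (div_neg_of_neg_of_pos hn hc.1))
  linarith

end SecondOrder

/-! ### The similarity action and the Hessian. -/

section Orbit

variable {N n p m : ℕ}

/-- The infinitesimal similarity action, bilinear in the triple and the generator. -/
noncomputable def tangent (n p m : ℕ) :
    Triple n p m →L[ℝ] Matrix (Fin n) (Fin n) ℝ →L[ℝ] Triple n p m :=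
  LinearMap.toContinuousLinearMap
    { toFun := fun x => LinearMap.toContinuousLinearMap
        { toFun := fun K => (K * x.1 - x.1 * K, K * x.2.1, -(x.2.2 * K))
          map_add' := fun K L => by
            refine Prod.ext ?_ (Prod.ext ?_ ?_)
            · simp only [Prod.fst_add, Matrix.add_mul, Matrix.mul_add]; abel
            · simp only [Prod.snd_add, Prod.fst_add, Matrix.add_mul]
            · simp only [Prod.snd_add, Matrix.mul_add]; abel
          map_smul' := fun r K => by
            refine Prod.ext ?_ (Prod.ext ?_ ?_) <;> simp [smul_sub] }
      map_add' := fun x y => by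
        refine ContinuousLinearMap.ext fun K => Prod.ext ?_ (Prod.ext ?_ ?_)
        · simp [Matrix.add_mul, Matrix.mul_add]; abel
        · simp [Matrix.mul_add]
        · simp [Matrix.add_mul]; abel
      map_smul' := fun r x => by
        refine ContinuousLinearMap.ext fun K => Prod.ext ?_ (Prod.ext ?_ ?_) <;>
          simp [smul_sub] }

theorem tangent_apply (x : Triple n p m) (K : Matrix (Fin n) (Fin n) ℝ) :
    tangent n p m x K = (K * x.1 - x.1 * K, K * x.2.1, -(x.2.2 * K)) := rfl

/-- The inverse of M is the inverse of left multiplication by M, applied to 1, so smoothness comes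
from inversion of linear maps. -/
theorem contDiffAt_matrix_inv {E : Type*} [NormedAddCommGroup E] [NormedSpace ℝ E]
    {k : WithTop ℕ∞} {y : E} {M : E → Matrix (Fin n) (Fin n) ℝ} (hM : ContDiffAt ℝ k M y)
    (hdet : IsUnit (M y).det) : ContDiffAt ℝ k (fun z => (M z)⁻¹) y := by
  have hequiv : ∀ X : Matrix (Fin n) (Fin n) ℝ, IsUnit X.det →
      ∃ e : Matrix (Fin n) (Fin n) ℝ ≃L[ℝ] Matrix (Fin n) (Fin n) ℝ,
        (e : Matrix (Fin n) (Fin n) ℝ →L[ℝ] Matrix (Fin n) (Fin n) ℝ) = mulBilin n n n X := by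
    intro X hX
    refine ⟨ContinuousLinearEquiv.equivOfInverse (mulBilin n n n X) (mulBilin n n n X⁻¹) ?_ ?_, ?_⟩
    · intro Y
      change X⁻¹ * (X * Y) = Y
      rw [← Matrix.mul_assoc, Matrix.nonsing_inv_mul _ hX, Matrix.one_mul]
    · intro Y
      change X * (X⁻¹ * Y) = Y
      rw [← Matrix.mul_assoc, Matrix.mul_nonsing_inv _ hX, Matrix.one_mul]
    · rfl
  have hsmooth : ContDiffAt ℝ k
      (fun z => ContinuousLinearMap.inverse (mulBilin n n n (M z)) 1) y := by
    obtain ⟨e, he⟩ := hequiv _ hdet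
    have h1 : ContDiffAt ℝ k (fun z => mulBilin n n n (M z)) y :=
      (mulBilin n n n).contDiff.contDiffAt.comp y hM
    have h3 : ContDiffAt ℝ k ContinuousLinearMap.inverse (mulBilin n n n (M y)) := by
      rw [← he]
      exact contDiffAt_map_inverse e
    exact (h3.comp y h1).clm_apply contDiffAt_const
  refine hsmooth.congr_of_eventuallyEq ?_
  have hev : ∀ᶠ z in 𝓝 y, (M z).det ≠ 0 :=
    (((continuous_id (X := Matrix (Fin n) (Fin n) ℝ)).matrix_det.continuousAt).comp
      hM.continuousAt).eventually_ne hdet.ne_zero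
  filter_upwards [hev] with z hz
  obtain ⟨e, he⟩ := hequiv _ (isUnit_iff_ne_zero.2 hz)
  refine Matrix.inv_eq_right_inv ?_
  change mulBilin n n n (M z) (ContinuousLinearMap.inverse (mulBilin n n n (M z)) 1) = 1
  rw [← he, ContinuousLinearMap.inverse_equiv]
  simp

theorem contDiffAt_act {E : Type*} [NormedAddCommGroup E] [NormedSpace ℝ E]
    {k : WithTop ℕ∞} {y : E} {T : E → Matrix (Fin n) (Fin n) ℝ} {x : E → Triple n p m}
    (hT : ContDiffAt ℝ k T y) (hx : ContDiffAt ℝ k x y) (hdet : IsUnit (T y).det) :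
    ContDiffAt ℝ k (fun z => act (T z) (x z)) y :=
  (contDiffAt_matrix_mul (contDiffAt_matrix_mul hT hx.fst) (contDiffAt_matrix_inv hT hdet)).prodMk
    ((contDiffAt_matrix_mul hT hx.snd.fst).prodMk
      (contDiffAt_matrix_mul hx.snd.snd (contDiffAt_matrix_inv hT hdet)))

theorem act_one (x : Triple n p m) : act 1 x = x := by
  simp [act]

/-- With z = 0 this identifies `tangent` as the differential of the orbit map at the identity; with
general z it is the differential of the slice map. -/
theorem hasDerivAt_act_line (x z : Triple n p m) (K : Matrix (Fin n) (Fin n) ℝ) :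
    HasDerivAt (fun t : ℝ => act (1 + t • K) (x + t • z)) (z + tangent n p m x K) 0 := by
  have hT := hasDerivAt_line (1 : Matrix (Fin n) (Fin n) ℝ) K 0
  have hA := hasDerivAt_line x.1 z.1 0
  have hB := hasDerivAt_line x.2.1 z.2.1 0
  have hC := hasDerivAt_line x.2.2 z.2.2 0
  have hI : HasDerivAt (fun t : ℝ => ((1 : Matrix (Fin n) (Fin n) ℝ) + t • K)⁻¹) (-K) 0 := by
    have hd : DifferentiableAt ℝ (fun t : ℝ => ((1 : Matrix (Fin n) (Fin n) ℝ) + t • K)⁻¹) 0 := by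
      refine (contDiffAt_matrix_inv (k := 1) ?_ (by simp)).differentiableAt one_ne_zero
      fun_prop
    have hprod := hasDerivAt_matrix_mul hT hd.hasDerivAt
    have hone : HasDerivAt (fun _ : ℝ => (1 : Matrix (Fin n) (Fin n) ℝ)) 0 0 := hasDerivAt_const _ _
    have hev : ∀ᶠ t : ℝ in 𝓝 0, ((1 : Matrix (Fin n) (Fin n) ℝ) + t • K).det ≠ 0 := by
      have hc : Continuous fun t : ℝ => ((1 : Matrix (Fin n) (Fin n) ℝ) + t • K).det :=
        Continuous.matrix_det (by fun_prop)
      exact hc.continuousAt.eventually_ne (by simp)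
    have h0 := hprod.unique (hone.congr_of_eventuallyEq (by
      filter_upwards [hev] with t ht
      exact Matrix.mul_nonsing_inv _ (isUnit_iff_ne_zero.2 ht)))
    simp only [zero_smul, add_zero, inv_one, Matrix.mul_one, Matrix.one_mul] at h0
    exact hd.hasDerivAt.congr_deriv (neg_eq_of_add_eq_zero_right h0).symm
  have h := (hasDerivAt_matrix_mul (hasDerivAt_matrix_mul hT hA) hI).prodMk
    ((hasDerivAt_matrix_mul hT hB).prodMk (hasDerivAt_matrix_mul hC hI))
  refine HasDerivAt.congr_deriv h ?_
  rw [tangent_apply]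
  refine Prod.ext ?_ (Prod.ext ?_ ?_)
  · simp only [zero_smul, add_zero, inv_one, Matrix.mul_one, Matrix.one_mul, Prod.fst_add,
      Matrix.mul_neg]
    abel
  · simp only [zero_smul, add_zero, Matrix.one_mul, Prod.fst_add, Prod.snd_add]
    abel
  · simp only [zero_smul, add_zero, inv_one, Matrix.mul_one, Prod.snd_add, Matrix.mul_neg]

theorem isHurwitz_act {T : Matrix (Fin n) (Fin n) ℝ} (hT : IsUnit T.det) {x : Triple n p m}
    (hx : IsHurwitz x.1) : IsHurwitz (act T x).1 := by
  intro s hs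
  have : (act T x).1.charpoly = x.1.charpoly := by
    rw [act, Matrix.charpoly_mul_comm, ← Matrix.mul_assoc, Matrix.nonsing_inv_mul _ hT,
      Matrix.one_mul]
  rw [det_pencil, this, ← det_pencil]
  exact hx s hs

theorem distSq_act {h : Triple N p m} {x : Triple n p m} (hh : IsHurwitz h.1) (hx : IsHurwitz x.1)
    {T : Matrix (Fin n) (Fin n) ℝ} (hT : IsUnit T.det) : distSq h (act T x) = distSq h x := by
  rw [← errorFn_transfer hh hx, ← errorFn_transfer hh (isHurwitz_act hT hx), errorFn, errorFn,
    transfer_act hT]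

theorem contDiffAt_distSq_right {k : WithTop ℕ∞} {h : Triple N p m} {x : Triple n p m}
    (hh : IsHurwitz h.1) (hx : IsHurwitz x.1) : ContDiffAt ℝ k (distSq h) x :=
  contDiffAt_distSq (h := fun _ => h) (x := fun z => z) contDiffAt_const contDiffAt_id hh hx

theorem eventually_isUnit_det_one_add :
    ∀ᶠ K : Matrix (Fin n) (Fin n) ℝ in 𝓝 0, IsUnit (1 + K).det := by
  have hc : Continuous fun K : Matrix (Fin n) (Fin n) ℝ => (1 + K).det :=
    Continuous.matrix_det (by fun_prop)
  filter_upwards [hc.continuousAt.eventually_ne (x := 0) (y := 0) (by simp)] with K hK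
  exact isUnit_iff_ne_zero.2 hK

theorem fderiv_distSq_tangent {h : Triple N p m} {x : Triple n p m} (hh : IsHurwitz h.1)
    (hx : IsHurwitz x.1) (K : Matrix (Fin n) (Fin n) ℝ) :
    fderiv ℝ (distSq h) x (tangent n p m x K) = 0 := by
  have h1 := hasDerivAt_act_line x 0 K
  simp only [smul_zero, add_zero, zero_add] at h1
  have hf : HasFDerivAt (distSq h) (fderiv ℝ (distSq h) x)
      (act (1 + (0 : ℝ) • K) x) := by
    rw [zero_smul, add_zero, act_one]
    exact (differentiableAt_distSq hh hx).hasFDerivAt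
  have h2 := HasFDerivAt.comp_hasDerivAt (l := distSq h) (0 : ℝ) hf h1
  have hK : Filter.Tendsto (fun t : ℝ => t • K) (𝓝 0) (𝓝 0) := by
    have hc : Continuous fun t : ℝ => t • K := by fun_prop
    simpa using hc.tendsto 0
  refine h2.unique ((hasDerivAt_const (0 : ℝ) (distSq h x)).congr_of_eventuallyEq ?_)
  filter_upwards [hK.eventually eventually_isUnit_det_one_add] with t ht
  exact distSq_act hh hx ht

/-- At a stationary point, the Hessian vanishes on the directions tangent to the similarity
class. -/
theorem hessian_tangent_eq_zero {h : Triple N p m} {x : Triple n p m} (hh : IsHurwitz h.1)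
    (hx : IsHurwitz x.1) (hcrit : fderiv ℝ (distSq h) x = 0) (w : Triple n p m)
    (K : Matrix (Fin n) (Fin n) ℝ) :
    fderiv ℝ (fderiv ℝ (distSq h)) x w (tangent n p m x K) = 0 := by
  have hx0 : x + (0 : ℝ) • w = x := by simp
  have hC2 : ContDiffAt ℝ 2 (distSq h) (x + (0 : ℝ) • w) := by
    rw [hx0]; exact contDiffAt_distSq_right hh hx
  have h1 : DifferentiableAt ℝ (fderiv ℝ (distSq h)) (x + (0 : ℝ) • w) :=
    (hC2.fderiv_right (m := 1) (by norm_num)).differentiableAt one_ne_zero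
  have h2 : HasDerivAt (fun t : ℝ => fderiv ℝ (distSq h) (x + t • w))
      (fderiv ℝ (fderiv ℝ (distSq h)) (x + (0 : ℝ) • w) w) 0 :=
    HasFDerivAt.comp_hasDerivAt (l := fderiv ℝ (distSq h)) (0 : ℝ) h1.hasFDerivAt
      (hasDerivAt_line x w 0)
  have h3 : HasDerivAt (fun t : ℝ => tangent n p m (x + t • w) K) (tangent n p m w K) 0 := by
    have := hasDerivAt_line (tangent n p m x K) (tangent n p m w K) 0
    refine this.congr_of_eventuallyEq (Filter.Eventually.of_forall fun t => ?_)
    simp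
  -- The first derivative kills orbit directions at every point of the line, so this product rule
  -- has value zero. The term that differentiates the tangent vector drops out by criticality,
  -- leaving the Hessian term.
  have h4 := h2.clm_apply h3
  have h5 := h4.unique ((hasDerivAt_const (0 : ℝ) (0 : ℝ)).congr_of_eventuallyEq (by
    have hev := (hasDerivAt_line x w 0).continuousAt.preimage_mem_nhds
      (isOpen_setOf_isHurwitz_fst.mem_nhds (show IsHurwitz (x + (0 : ℝ) • w).1 by rwa [hx0]))
    filter_upwards [hev] with t ht
    exact fderiv_distSq_tangent hh ht K))
  simpa [hx0, hcrit] using h5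

theorem hessian_symm {h : Triple N p m} {x : Triple n p m} (hh : IsHurwitz h.1)
    (hx : IsHurwitz x.1) (v w : Triple n p m) :
    fderiv ℝ (fderiv ℝ (distSq h)) x v w = fderiv ℝ (fderiv ℝ (distSq h)) x w v :=
  ((contDiffAt_distSq_right (k := 2) hh hx).isSymmSndFDerivAt (by simp)).eq v w

/-- Continuity is needed jointly in target and model, because both move under the deformation. -/
theorem continuousAt_hessian {h : Triple N p m} {x : Triple n p m} (hh : IsHurwitz h.1)
    (hx : IsHurwitz x.1) :
    ContinuousAt (fun q : Triple N p m × Triple n p m =>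
      fderiv ℝ (fderiv ℝ (distSq q.1)) q.2) (h, x) := by
  have h1 : ContDiffAt ℝ 1 (fun q : Triple N p m × Triple n p m =>
      fderiv ℝ (distSq q.1) q.2) (h, x) := by
    refine ContDiffAt.fderiv (n := 2) (f := fun (q : Triple N p m × Triple n p m) y =>
      distSq q.1 y) (g := fun q => q.2) ?_ contDiffAt_snd (by norm_num)
    exact contDiffAt_distSq (h := fun r : (Triple N p m × Triple n p m) × Triple n p m => r.1.1)
      (x := fun r => r.2) contDiffAt_fst.fst contDiffAt_snd hh hx
  have h2 : ContDiffAt ℝ 0 (fun q : Triple N p m × Triple n p m =>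
      fderiv ℝ (fderiv ℝ (distSq q.1)) q.2) (h, x) := by
    refine ContDiffAt.fderiv (n := 1) (f := fun (q : Triple N p m × Triple n p m) y =>
      fderiv ℝ (distSq q.1) y) (g := fun q => q.2) ?_ contDiffAt_snd (by norm_num)
    have hg : ContDiffAt ℝ 1 (fun r : (Triple N p m × Triple n p m) × Triple n p m =>
        (r.1.1, r.2)) ((h, x), x) := contDiffAt_fst.fst.prodMk contDiffAt_snd
    exact ContDiffAt.comp (g := fun q : Triple N p m × Triple n p m =>
      fderiv ℝ (distSq q.1) q.2) ((h, x), x) h1 hg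
  exact h2.continuousAt

end Orbit

/-! ### Persistence of nondegenerate minima. -/

section Persistence

variable {N n p m : ℕ}

theorem isSimilarityTangent_iff {x v : Triple n p m} :
    IsSimilarityTangent x v ↔ ∃ K, v = tangent n p m x K := Iff.rfl

/-- Surjectivity of the slice map persists. -/
theorem eventually_exists_eq_add_tangent {x₀ : Triple n p m} {Z : Submodule ℝ (Triple n p m)}
    (hZ : ∀ v, ∃ z ∈ Z, ∃ K, v = z + tangent n p m x₀ K) :
    ∀ᶠ x in 𝓝 x₀, ∀ v, ∃ z ∈ Z, ∃ K, v = z + tangent n p m x K := by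
  let ψ : (Z × Matrix (Fin n) (Fin n) ℝ) →ₗ[ℝ] Triple n p m :=
    LinearMap.coprod Z.subtype (tangent n p m x₀).toLinearMap
  have hψ : LinearMap.range ψ = ⊤ := by
    rw [LinearMap.range_eq_top]
    intro v
    obtain ⟨z, hz, K, hK⟩ := hZ v
    exact ⟨(⟨z, hz⟩, K), by rw [hK]; rfl⟩
  -- A right inverse at x₀, with components a into Z and b into the generators, is kept fixed. The
  -- map a + tangent(x) ∘ b is the identity at x₀, hence invertible for x near x₀.
  obtain ⟨σ, hσ⟩ := ψ.exists_rightInverse_of_surjective hψ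
  let a : Triple n p m →L[ℝ] Triple n p m :=
    LinearMap.toContinuousLinearMap (Z.subtype ∘ₗ LinearMap.fst ℝ _ _ ∘ₗ σ)
  let b : Triple n p m →L[ℝ] Matrix (Fin n) (Fin n) ℝ :=
    LinearMap.toContinuousLinearMap (LinearMap.snd ℝ _ _ ∘ₗ σ)
  have hc : Continuous fun x => a + (tangent n p m x).comp b :=
    continuous_const.add ((tangent n p m).continuous.clm_comp continuous_const)
  have hone : a + (tangent n p m x₀).comp b = 1 := by
    refine ContinuousLinearMap.ext fun v => ?_
    exact LinearMap.congr_fun hσ v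
  have hopen : ∀ᶠ x in 𝓝 x₀, IsUnit (a + (tangent n p m x).comp b) := by
    refine hc.continuousAt.preimage_mem_nhds (Units.isOpen.mem_nhds ?_)
    rw [hone]
    exact isUnit_one
  filter_upwards [hopen] with x hx v
  obtain ⟨u, hu⟩ := hx
  refine ⟨a (u⁻¹.1 v), ((σ (u⁻¹.1 v)).1).2, b (u⁻¹.1 v), ?_⟩
  have h1 : u.1 (u⁻¹.1 v) = v := by
    rw [← mul_apply_eq_comp, u.mul_inv]
    rfl
  conv_lhs => rw [← h1, hu]
  rfl

/-- Positivity of a continuous family of quadratic forms on a subspace persists. -/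
theorem eventually_hessian_pos {h₀ : Triple N p m} {x₀ : Triple n p m} (hh : IsHurwitz h₀.1)
    (hx : IsHurwitz x₀.1) {Z : Submodule ℝ (Triple n p m)}
    (hpos : ∀ z ∈ Z, z ≠ 0 → 0 < fderiv ℝ (fderiv ℝ (distSq h₀)) x₀ z z) :
    ∀ᶠ q : Triple N p m × Triple n p m in 𝓝 (h₀, x₀), ∀ z ∈ Z, z ≠ 0 →
      0 < fderiv ℝ (fderiv ℝ (distSq q.1)) q.2 z z := by
  -- The unit sphere of Z is compact, so the tube lemma makes the neighborhood uniform; homogeneity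
  -- extends positivity to all nonzero z.
  have hK : IsCompact ((Z : Set (Triple n p m)) ∩ Metric.sphere 0 1) := by
    have : ProperSpace (Triple n p m) := FiniteDimensional.proper ℝ _
    exact (isCompact_sphere _ _).inter_left Z.closed_of_finiteDimensional
  have hev := hK.eventually_forall_of_forall_eventually (x₀ := (h₀, x₀))
    (P := fun q z => 0 < fderiv ℝ (fderiv ℝ (distSq q.1)) q.2 z z) (by
      rintro z ⟨hzZ, hz1⟩
      have hz0 : z ≠ 0 := by
        rintro rfl
        simp at hz1
      have c1 : ContinuousAt (fun r : (Triple N p m × Triple n p m) × Triple n p m =>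
          fderiv ℝ (fderiv ℝ (distSq r.1.1)) r.1.2) ((h₀, x₀), z) :=
        ContinuousAt.comp (g := fun q : Triple N p m × Triple n p m =>
          fderiv ℝ (fderiv ℝ (distSq q.1)) q.2) (continuousAt_hessian hh hx) continuousAt_fst
      have c2 : ContinuousAt (fun r : (Triple N p m × Triple n p m) × Triple n p m =>
          fderiv ℝ (fderiv ℝ (distSq r.1.1)) r.1.2 r.2 r.2) ((h₀, x₀), z) :=
        (c1.clm_apply continuousAt_snd).clm_apply continuousAt_snd
      exact c2.eventually (lt_mem_nhds (hpos z hzZ hz0)))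
  filter_upwards [hev] with q hq z hzZ hz0
  have hn : 0 < ‖z‖ := norm_pos_iff.2 hz0
  have h1 := hq (‖z‖⁻¹ • z) ⟨Z.smul_mem _ hzZ, by
    rw [mem_sphere_zero_iff_norm, norm_smul, norm_inv, norm_norm, inv_mul_cancel₀ hn.ne']⟩
  simp only [map_smul, smul_apply, smul_eq_mul] at h1
  have h2 : 0 < ‖z‖⁻¹ := inv_pos.2 hn
  exact pos_of_mul_pos_right (pos_of_mul_pos_right h1 h2.le) h2.le

/-- A critical point is a local minimum if the Hessian is nonnegative near it on a complement of the
tangent space to the similarity class. -/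
theorem isLocalMin_of_hessian_nonneg {h : Triple N p m} {y : Triple n p m}
    {s : Set (Triple n p m)} (hs : Convex ℝ s) (hsy : s ∈ 𝓝 y) (hh : IsHurwitz h.1)
    (hsH : ∀ x ∈ s, IsHurwitz x.1) {Z : Submodule ℝ (Triple n p m)}
    (hZ : ∀ v, ∃ z ∈ Z, ∃ K, v = z + tangent n p m y K)
    (hpos : ∀ x ∈ s, ∀ z ∈ Z, 0 ≤ fderiv ℝ (fderiv ℝ (distSq h)) x z z)
    (hcrit : fderiv ℝ (distSq h) y = 0) : IsLocalMin (distSq h) y := by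
  let Φ : Matrix (Fin n) (Fin n) ℝ × Z → Triple n p m := fun q => act (1 + q.1) (y + (q.2 : Triple n p m))
  have hΦ0 : Φ 0 = y := by simp [Φ, act_one]
  have hsub : Continuous fun q : Matrix (Fin n) (Fin n) ℝ × Z => y + (q.2 : Triple n p m) := by
    fun_prop
  have hΦ : ContDiffAt ℝ 1 Φ 0 := by
    refine contDiffAt_act ?_ ?_ (by simp)
    · exact contDiffAt_const.add contDiffAt_fst
    · exact contDiffAt_const.add (Z.subtypeL.contDiff.contDiffAt.comp _ contDiffAt_snd)
  have hstrict := hΦ.hasStrictFDerivAt one_ne_zero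
  have hfd : ∀ (K : Matrix (Fin n) (Fin n) ℝ) (z : Z),
      fderiv ℝ Φ 0 (K, z) = z + tangent n p m y K := by
    intro K z
    have h1 : HasFDerivAt Φ (fderiv ℝ Φ 0)
        ((0 : Matrix (Fin n) (Fin n) ℝ × Z) + (0 : ℝ) • (K, z)) := by
      simpa using hstrict.hasFDerivAt
    have h2 := HasFDerivAt.comp_hasDerivAt (l := Φ) (0 : ℝ) h1 (hasDerivAt_line 0 (K, z) 0)
    have h3 := hasDerivAt_act_line y (z : Triple n p m) K
    refine h2.unique (h3.congr_of_eventuallyEq (Filter.Eventually.of_forall fun t => ?_))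
    simp [Φ]
  have hsurj : LinearMap.range (fderiv ℝ Φ 0).toLinearMap = ⊤ := by
    rw [LinearMap.range_eq_top]
    intro v
    obtain ⟨z, hz, K, hK⟩ := hZ v
    exact ⟨(K, ⟨z, hz⟩), by rw [hK]; exact hfd K ⟨z, hz⟩⟩
  -- Surjectivity of the derivative means that the slice map covers a neighborhood of y. As the
  -- distance is invariant under similarity, it suffices to compare y with y + z for small z in Z.
  have hmap := hstrict.map_nhds_eq_of_surj hsurj
  rw [hΦ0] at hmap
  change ∀ᶠ x in 𝓝 y, distSq h y ≤ distSq h x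
  rw [← hmap, Filter.eventually_map]
  have e1 : ∀ᶠ q : Matrix (Fin n) (Fin n) ℝ × Z in 𝓝 0, IsUnit (1 + q.1).det :=
    (continuous_fst.tendsto (0 : Matrix (Fin n) (Fin n) ℝ × Z)).eventually
      eventually_isUnit_det_one_add
  have e2 : ∀ᶠ q : Matrix (Fin n) (Fin n) ℝ × Z in 𝓝 0, y + (q.2 : Triple n p m) ∈ s := by
    refine hsub.continuousAt.preimage_mem_nhds ?_
    simpa using hsy
  filter_upwards [e1, e2] with q h1 h2
  rw [show distSq h (Φ q) = distSq h (y + (q.2 : Triple n p m)) from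
    distSq_act hh (hsH _ h2) h1]
  exact le_of_fderiv_fderiv_nonneg hs (fun x hx => contDiffAt_distSq_right hh (hsH x hx))
    (fun x hx => hpos x hx _ q.2.2) (mem_of_mem_nhds hsy) h2 hcrit

/-- At stationary points, being a nondegenerate local minimum is stable under perturbation of both
arguments of the distance. -/
theorem eventually_isLocalMin_and_nondegenerate {h₀ : Triple N p m} {x₀ : Triple n p m}
    (hh : IsHurwitz h₀.1) (hx : IsHurwitz x₀.1) (hmin : IsLocalMin (distSq h₀) x₀)
    (hnd : ∀ v, (∀ w, fderiv ℝ (fderiv ℝ (distSq h₀)) x₀ v w = 0) → IsSimilarityTangent x₀ v) :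
    ∀ᶠ q : Triple N p m × Triple n p m in 𝓝 (h₀, x₀),
      HasFDerivAt (distSq q.1) (0 : Triple n p m →L[ℝ] ℝ) q.2 →
        IsLocalMin (distSq q.1) q.2 ∧
        ∀ v, (∀ w, fderiv ℝ (fderiv ℝ (distSq q.1)) q.2 v w = 0) →
          IsSimilarityTangent q.2 v := by
  -- Z is chosen once, complementary to the orbit directions at x₀; at nearby points only spanning
  -- is needed, not a direct sum.
  obtain ⟨Z, hTZ⟩ := Submodule.exists_isCompl (LinearMap.range (tangent n p m x₀).toLinearMap)
  have hZ : ∀ v, ∃ z ∈ Z, ∃ K, v = z + tangent n p m x₀ K := by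
    intro v
    have hv : v ∈ LinearMap.range (tangent n p m x₀).toLinearMap ⊔ Z := by
      rw [hTZ.sup_eq_top]; trivial
    obtain ⟨_, ⟨K, rfl⟩, z, hz, rfl⟩ := Submodule.mem_sup.1 hv
    exact ⟨z, hz, K, add_comm _ _⟩
  have hpos : ∀ z ∈ Z, z ≠ 0 → 0 < fderiv ℝ (fderiv ℝ (distSq h₀)) x₀ z z := by
    intro z hz hz0
    have hnn := fun v => fderiv_fderiv_nonneg_of_isLocalMin (contDiffAt_distSq_right hh hx) hmin v
    refine lt_of_le_of_ne (hnn z) fun h0 => hz0 ?_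
    obtain ⟨K, hK⟩ := isSimilarityTangent_iff.1 (hnd z fun w =>
      form_apply_eq_zero_of_nonneg (hessian_symm hh hx) hnn h0.symm w)
    exact Submodule.disjoint_def.1 hTZ.disjoint z ⟨K, hK.symm⟩ hz
  have e1 := eventually_hessian_pos hh hx hpos
  rw [nhds_prod_eq] at e1 ⊢
  obtain ⟨pa, ha, pb, hb, hab⟩ := Filter.eventually_prod_iff.1 e1
  have e2 : ∀ᶠ x in 𝓝 x₀, pb x ∧ IsHurwitz x.1 :=
    hb.and (isOpen_setOf_isHurwitz_fst.mem_nhds hx)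
  obtain ⟨r, hr, hball⟩ := Metric.eventually_nhds_iff_ball.1 e2
  have e3 : ∀ᶠ h in 𝓝 h₀, pa h ∧ IsHurwitz h.1 :=
    ha.and (isOpen_setOf_isHurwitz_fst.mem_nhds hh)
  have e4 := (eventually_exists_eq_add_tangent hZ).and (Metric.ball_mem_nhds x₀ hr)
  filter_upwards [e3.prod_mk e4] with q hq hst
  obtain ⟨⟨hpa, hqh⟩, hqZ, hqb⟩ := hq
  have hqx : IsHurwitz q.2.1 := (hball _ hqb).2
  refine ⟨isLocalMin_of_hessian_nonneg (convex_ball x₀ r) (Metric.isOpen_ball.mem_nhds hqb) hqh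
    (fun x hx => (hball x hx).2) hqZ ?_ hst.fderiv, ?_⟩
  · intro x hx z hz
    rcases eq_or_ne z 0 with rfl | hz0
    · simp
    · exact (hab hpa (hball x hx).1 z hz hz0).le
  · intro v hv
    obtain ⟨z, hz, K, hK⟩ := hqZ v
    -- Write a kernel vector as v = z + tangent. Pairing z with v gives zero by symmetry, pairing it
    -- with the tangent part gives zero by stationarity, so the Hessian vanishes on (z, z).
    have hz0 : z = 0 := by
      by_contra hne
      refine (hab hpa (hball _ hqb).1 z hz hne).ne' ?_
      have e : z = v - tangent n p m q.2 K := by rw [hK]; abel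
      have e5 : fderiv ℝ (fderiv ℝ (distSq q.1)) q.2 z (tangent n p m q.2 K) = 0 :=
        hessian_tangent_eq_zero hqh hqx hst.fderiv z K
      have e6 : fderiv ℝ (fderiv ℝ (distSq q.1)) q.2 z v = 0 := by
        rw [hessian_symm hqh hqx]
        exact hv z
      have e7 : fderiv ℝ (fderiv ℝ (distSq q.1)) q.2 z (v - tangent n p m q.2 K) = 0 := by
        rw [map_sub, e6, e5, sub_zero]
      rw [← e] at e7
      exact e7
    exact isSimilarityTangent_iff.2 ⟨K, by rw [hK, hz0, zero_add]⟩

end Persistence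

/-! ### Passing between realizations and transfer functions. -/

section Descent

variable {N n p m : ℕ}

theorem isLocalMin_distSq_of_isLocalMin {h : Triple N p m} {x : Triple n p m} (hh : IsHurwitz h.1)
    (hx : IsHurwitz x.1) (hmin : IsMinimal x)
    (hloc : IsLocalMin (fun G : RatTF n p m => h2NormSq (transfer h - G.1))
      (RatTF.ofMinimal ⟨x, hmin⟩)) : IsLocalMin (distSq h) x := by
  have h1 : ∀ᶠ y : {y : Triple n p m // IsMinimal y} in 𝓝 ⟨x, hmin⟩,
      h2NormSq (transfer h - transfer x) ≤ h2NormSq (transfer h - transfer y.1) :=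
    continuous_ofMinimal.continuousAt.eventually hloc
  have h2 : ∀ᶠ y in 𝓝 x, h2NormSq (transfer h - transfer x) ≤ h2NormSq (transfer h - transfer y) := by
    have := (isOpen_isMinimal (n := n) (p := p) (m := m)).isOpenEmbedding_subtypeVal.map_nhds_eq
      ⟨x, hmin⟩
    rw [← show Filter.map Subtype.val (𝓝 (⟨x, hmin⟩ : {y : Triple n p m // IsMinimal y})) = 𝓝 x
      from this]
    exact h1
  filter_upwards [h2, isOpen_setOf_isHurwitz_fst.mem_nhds hx] with y hy hyH
  rw [h2NormSq_transfer_sub hh hx, h2NormSq_transfer_sub hh hyH] at hy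
  exact (ENNReal.ofReal_le_ofReal_iff (distSq_nonneg hh hyH)).1 hy

/-- Openness of the quotient map is what makes nearby minimal triples cover a whole neighborhood of
transfer functions. -/
theorem isLocalMin_of_isLocalMin_distSq {h : Triple N p m} {x : Triple n p m} (hh : IsHurwitz h.1)
    (hx : IsHurwitz x.1) (hmin : IsMinimal x) (hloc : IsLocalMin (distSq h) x) :
    IsLocalMin (fun G : RatTF n p m => h2NormSq (transfer h - G.1))
      (RatTF.ofMinimal ⟨x, hmin⟩) := by
  have h1 : ∀ᶠ y in 𝓝 x, h2NormSq (transfer h - transfer x) ≤ h2NormSq (transfer h - transfer y) := by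
    filter_upwards [hloc, isOpen_setOf_isHurwitz_fst.mem_nhds hx] with y hy hyH
    rw [h2NormSq_transfer_sub hh hx, h2NormSq_transfer_sub hh hyH]
    exact ENNReal.ofReal_le_ofReal hy
  have h2 : ∀ᶠ y : {y : Triple n p m // IsMinimal y} in 𝓝 ⟨x, hmin⟩,
      h2NormSq (transfer h - transfer x) ≤ h2NormSq (transfer h - transfer y.1) :=
    (continuous_subtype_val.tendsto
      (⟨x, hmin⟩ : {y : Triple n p m // IsMinimal y})).eventually h1
  filter_upwards [isOpenMap_ofMinimal.image_mem_nhds h2] with G hG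
  obtain ⟨y, hy, rfl⟩ := hG
  exact hy

/-- Reduction of a perturbation statement for transfer functions to one for realizations. -/
theorem exists_nhds_of_deformation {h : Triple N p m} {x : Triple n p m} (hmin : IsMinimal h)
    (hxmin : IsMinimal x) (hh : IsHurwitz h.1) (hx : IsHurwitz x.1)
    {Q : RatMatrix p m → RatTF n p m → Prop} {g : Triple n p m → Triple N p m} (hgx : g x = h)
    (hg : ContinuousAt g x)
    (hQ : ∀ᶠ y in 𝓝 x, ∀ hy : IsMinimal y, IsHurwitz (g y).1 → IsHurwitz y.1 →
      Q (transfer (g y)) (RatTF.ofMinimal ⟨y, hy⟩))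
    {U : Set (RatTF N p m)} (hU : U ∈ 𝓝 (RatTF.ofMinimal ⟨h, hmin⟩)) :
    ∃ V ∈ 𝓝 (RatTF.ofMinimal ⟨x, hxmin⟩), ∀ G ∈ V, ∃ F ∈ U,
      IsStable F.1 ∧ IsStable G.1 ∧ Q F.1 G := by
  have hU' : Subtype.val '' (RatTF.ofMinimal ⁻¹' U) ∈ 𝓝 (g x) := by
    rw [hgx]
    exact (isOpen_isMinimal (n := N) (p := p) (m := m)).isOpenMap_subtype_val.image_mem_nhds
      (continuous_ofMinimal.continuousAt.preimage_mem_nhds hU)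
  have hgH : ∀ᶠ y in 𝓝 x, IsHurwitz (g y).1 :=
    hg.preimage_mem_nhds (isOpen_setOf_isHurwitz_fst.mem_nhds
      (show IsHurwitz (g x).1 by rwa [hgx]))
  have hgU : ∀ᶠ y in 𝓝 x, g y ∈ Subtype.val '' (RatTF.ofMinimal ⁻¹' U) := hg.preimage_mem_nhds hU'
  have hall := (hgU.and hgH).and
    (Filter.Eventually.and (isOpen_setOf_isHurwitz_fst.mem_nhds hx) hQ)
  refine ⟨_, isOpenMap_ofMinimal.image_mem_nhds
    ((continuous_subtype_val.continuousAt (x := (⟨x, hxmin⟩ : {y : Triple n p m // IsMinimal y}))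
      ).preimage_mem_nhds hall), ?_⟩
  rintro _ ⟨y, ⟨⟨⟨k, hkU, hk⟩, hgy⟩, hyH, hyQ⟩, rfl⟩
  refine ⟨RatTF.ofMinimal k, hkU, ?_, isStable_transfer hyH, ?_⟩
  · change IsStable (transfer k.1)
    rw [hk]
    exact isStable_transfer hgy
  · change Q (transfer k.1) _
    rw [hk]
    exact hyQ y.2 hgy hyH

end Descent
end H2

/-! ### The theorem. -/

open H2 in
theorem theorem6p3 {N n p m : ℕ} (H : H2.RatTF N p m) (Hhat : H2.RatTF n p m)
    (hH : H2.IsStable H.1) (hHhat : H2.IsStable Hhat.1) :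
    (H2.IsStationaryPoint H.1 Hhat →
      ∀ U ∈ 𝓝 H, ∃ Uhat ∈ 𝓝 Hhat, ∀ HhatD ∈ Uhat, ∃ HD ∈ U,
        H2.IsStable HD.1 ∧ H2.IsStable HhatD.1 ∧ H2.IsStationaryPoint HD.1 HhatD) ∧
    (H2.IsNondegLocalMin H.1 Hhat →
      ∀ U ∈ 𝓝 H, ∃ Uhat ∈ 𝓝 Hhat, ∀ HhatD ∈ Uhat, ∃ HD ∈ U,
        H2.IsStable HD.1 ∧ H2.IsStable HhatD.1 ∧ H2.IsNondegLocalMin HD.1 HhatD) := by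
  obtain ⟨_, h, hmin, rfl⟩ := H
  have hh : IsHurwitz h.1 := isHurwitz_of_isStable_transfer hmin hH
  constructor
  · rintro ⟨x, hxmin, hxt, hst⟩ U hU
    obtain rfl : RatTF.ofMinimal ⟨x, hxmin⟩ = Hhat := Subtype.ext hxt
    have hx : IsHurwitz x.1 := isHurwitz_of_isStable_transfer hxmin hHhat
    have hst' : HasFDerivAt (distSq h) (0 : Triple n p m →L[ℝ] ℝ) x :=
      hst.congr_of_eventuallyEq (eventuallyEq_errorFn hh hx).symm
    obtain ⟨g, hgx, hgc, hg⟩ := exists_stationary_deformation hxmin hh hx hst'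
    refine exists_nhds_of_deformation hmin hxmin hh hx (Q := fun E G => IsStationaryPoint E G)
      hgx hgc ?_ hU
    filter_upwards [hg] with y hy hymin hgy hyH
    exact ⟨y, hymin, rfl, hy.congr_of_eventuallyEq (eventuallyEq_errorFn hgy hyH)⟩
  · rintro ⟨hloc, x, hxmin, hxt, hnd⟩ U hU
    obtain rfl : RatTF.ofMinimal ⟨x, hxmin⟩ = Hhat := Subtype.ext hxt
    have hx : IsHurwitz x.1 := isHurwitz_of_isStable_transfer hxmin hHhat
    have hmin' := isLocalMin_distSq_of_isLocalMin hh hx hxmin hloc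
    -- A local minimum is stationary, so the deformation used for stationary points applies here
    -- too.
    have hst : HasFDerivAt (distSq h) (0 : Triple n p m →L[ℝ] ℝ) x := by
      rw [← hmin'.fderiv_eq_zero]
      exact (differentiableAt_distSq hh hx).hasFDerivAt
    rw [(eventuallyEq_errorFn hh hx).fderiv.fderiv_eq] at hnd
    obtain ⟨g, hgx, hgc, hg⟩ := exists_stationary_deformation hxmin hh hx hst
    have hev := eventually_isLocalMin_and_nondegenerate hh hx hmin' hnd
    have hgq : Filter.Tendsto (fun y => (g y, y)) (𝓝 x) (𝓝 (h, x)) := by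
      have := (hgc.prodMk continuousAt_id).tendsto
      rwa [hgx] at this
    refine exists_nhds_of_deformation hmin hxmin hh hx (Q := fun E G => IsNondegLocalMin E G)
      hgx hgc ?_ hU
    filter_upwards [hg, hgq.eventually hev] with y hy hyq hymin hgy hyH
    obtain ⟨h1, h2⟩ := hyq hy
    refine ⟨isLocalMin_of_isLocalMin_distSq hgy hyH hymin h1, y, hymin, rfl, ?_⟩
    rw [(eventuallyEq_errorFn hgy hyH).fderiv.fderiv_eq]
    exact h2
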